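/- For $m\ge 1$ let $\mathrm H_m$ be the real vector space of $m\times m$ complex Hermitian matrices and let $\mathcal P_m\subseteq \mathrm H_m$ be the set of pure states, i.e. of Hermitian matrices of rank one and trace one. Let $k>1$, let $n_1\ge\cdots\ge n_k\ge 2$ be integers, put $N=\prod_{i=1}^k n_i$, and identify $\mathrm H_N$ with $\bigotimes_{i=1}^k \mathrm H_{n_i}$ through the Kronecker product. Write $\otimes_{i=1}^k\mathcal P_{n_i}=\{P_1\otimes\cdots\otimes P_k : P_i\in\mathcal P_{n_i},\ i=1,\dots,k\}$ for the set of product pure states. Let $\Psi:\mathrm H_N\to\mathrm H_N$ be a real-linear map. The following are equivalent. (a) $\Psi\left(\otimes_{i=1}^k\mathcal P_{n_i}\right)=\otimes_{i=1}^k\mathcal P_{n_i}$. (b) $\Psi\left(\operatorname{conv}(\otimes_{i=1}^k\mathcal P_{n_i})\right)=\operatorname{conv}\left(\otimes_{i=1}^k\mathcal P_{n_i}\right)$, i.e. $\Psi$ maps the set of separable states onto itself. (c) There are a permutation $\pi$ of $\{1,\dots,k\}$ with $n_{\pi(i)}=n_i$ for all $i$, and real-linear maps $\psi_i$ on $\mathrm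 H_{n_i}$ for $i=1,\dots,k$, such that $$\Psi(A_1\otimes\cdots\otimes A_k)=\psi_1(A_{\pi(1)})\otimes\cdots\otimes\psi_k(A_{\pi(k)})\quad\text{for all } A_i\in\mathrm H_{n_i},\ i=1,\dots,k,$$ where, for each $i$, $\psi_i$ has the form $X\mapsto U_iXU_i^*$ or $X\mapsto U_iX^{T}U_i^*$ for some unitary $n_i\times n_i$ complex matrix $U_i$. -/

import Mathlib

open scoped Matrix

/-- The real vector space of complex Hermitian matrices with rows and columns indexed by `ι`. -/
abbrev Herm (ι : Type) [Fintype ι] [DecidableEq ι] : Type :=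
  selfAdjoint (Matrix ι ι ℂ)

/-- Pure states: Hermitian matrices of rank one and trace one. -/
def pureStates (ι : Type) [Fintype ι] [DecidableEq ι] : Set (Herm ι) :=
  {P | (P : Matrix ι ι ℂ).rank = 1 ∧ (P : Matrix ι ι ℂ).trace = 1}

/-- Index set of the standard product basis of `ℂ^{n_1} ⊗ ⋯ ⊗ ℂ^{n_k}`; it has `∏ i, n i`
elements. -/
abbrev ProdIdx {k : ℕ} (n : Fin k → ℕ) : Type := (i : Fin k) → Fin (n i)

/-- The tensor (Kronecker) product `A_1 ⊗ ⋯ ⊗ A_k` of Hermitian matrices, in the product basis. -/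
def tensorHerm {k : ℕ} {n : Fin k → ℕ} (A : (i : Fin k) → Herm (Fin (n i))) :
    Herm (ProdIdx n) :=
  ⟨Matrix.of fun a b => ∏ i, (A i : Matrix (Fin (n i)) (Fin (n i)) ℂ) (a i) (b i), by
    rw [selfAdjoint.mem_iff]
    ext a b
    rw [Matrix.star_apply, Matrix.of_apply, Matrix.of_apply, star_prod]
    refine Finset.prod_congr rfl fun i _ => ?_
    rw [← Matrix.star_apply, selfAdjoint.mem_iff.mp (A i).2]⟩

/-- Product pure states `P_1 ⊗ ⋯ ⊗ P_k`. -/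
def productPureStates {k : ℕ} (n : Fin k → ℕ) : Set (Herm (ProdIdx n)) :=
  {T | ∃ P : (i : Fin k) → Herm (Fin (n i)),
    (∀ i, P i ∈ pureStates (Fin (n i))) ∧ T = tensorHerm P}

/-- Separable states: the convex hull of the product pure states. -/
def separableStates {k : ℕ} (n : Fin k → ℕ) : Set (Herm (ProdIdx n)) :=
  convexHull ℝ (productPureStates n)

/-- The identification of Hermitian matrices of equal sizes `m = n`. -/
def castHerm {m n : ℕ} (h : m = n) (A : Herm (Fin m)) : Herm (Fin n) :=
  ⟨(A : Matrix (Fin m) (Fin m) ℂ).submatrix (Fin.cast h.symm) (Fin.cast h.symm), by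
    subst h
    exact A.2⟩

/-- `ψ` is `X ↦ U X U*` for a unitary `U`, or `X ↦ U Xᵀ U*` for a unitary `U`. -/
def IsUnitaryConjOrTranspose {m : ℕ} (ψ : Herm (Fin m) →ₗ[ℝ] Herm (Fin m)) : Prop :=
  ∃ U ∈ Matrix.unitaryGroup (Fin m) ℂ,
    (∀ X, (ψ X : Matrix (Fin m) (Fin m) ℂ) = U * (X : Matrix (Fin m) (Fin m) ℂ) * Uᴴ) ∨
    (∀ X, (ψ X : Matrix (Fin m) (Fin m) ℂ) = U * (X : Matrix (Fin m) (Fin m) ℂ)ᵀ * Uᴴ)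

/-! ### Pure states as projections onto unit vectors -/

section PureStates

variable {ι : Type} [Fintype ι] [DecidableEq ι]

/-- The Hermitian matrix `x x*`. -/
def outerHerm (x : ι → ℂ) : Herm ι :=
  ⟨Matrix.vecMulVec x (star x), by
    rw [selfAdjoint.mem_iff, Matrix.star_eq_conjTranspose]
    ext a b
    simp [Matrix.vecMulVec_apply, mul_comm]⟩

theorem outerHerm_apply (x : ι → ℂ) (a b : ι) :
    (outerHerm x : Matrix ι ι ℂ) a b = x a * star (x b) := rfl

theorem coe_outerHerm (x : ι → ℂ) :
    (outerHerm x : Matrix ι ι ℂ) = Matrix.vecMulVec x (star x) := rfl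

theorem isHermitian_coe (A : Herm ι) : (A : Matrix ι ι ℂ).IsHermitian := A.2

/-- Spectral decomposition of a Hermitian matrix into multiples of projections. -/
theorem exists_eq_sum_outerHerm (A : Herm ι) :
    ∃ v : ι → ι → ℂ, (∀ i, v i ⬝ᵥ star (v i) = 1) ∧
      A = ∑ i, (isHermitian_coe A).eigenvalues i • outerHerm (v i) := by
  have hA := isHermitian_coe A
  refine ⟨fun i => ⇑(hA.eigenvectorBasis i), fun i => ?_, ?_⟩
  · have h := hA.eigenvectorBasis.orthonormal.1 i
    have h2 : (inner ℂ (hA.eigenvectorBasis i) (hA.eigenvectorBasis i) : ℂ) = 1 := by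
      rw [inner_self_eq_norm_sq_to_K, h]; simp
    rw [EuclideanSpace.inner_eq_star_dotProduct] at h2
    exact h2
  · apply Subtype.ext
    conv_lhs => rw [hA.spectral_theorem]
    ext a b
    rw [Unitary.conjStarAlgAut_apply, Matrix.mul_apply]
    simp only [Matrix.mul_diagonal, Function.comp, Matrix.star_apply,
      Matrix.IsHermitian.eigenvectorUnitary_apply]
    rw [AddSubgroup.val_finsetSum, Matrix.sum_apply]
    refine Finset.sum_congr rfl fun i _ => ?_
    rw [selfAdjoint.val_smul, Matrix.smul_apply, outerHerm_apply]
    simp only [Complex.real_smul]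
    change _ * (((isHermitian_coe A).eigenvalues i : ℝ) : ℂ) * _ = _
    ring

/-- Rank counts nonzero eigenvalues, so one term of the spectral decomposition survives and the
trace makes its eigenvalue one. Conversely `x x*` has rank at most one, and trace one excludes rank
zero. -/
theorem mem_pureStates_iff {P : Herm ι} :
    P ∈ pureStates ι ↔ ∃ x : ι → ℂ, x ⬝ᵥ star x = 1 ∧ P = outerHerm x := by
  constructor
  · rintro ⟨hr, ht⟩
    obtain ⟨v, hv, hP⟩ := exists_eq_sum_outerHerm P
    set hA := isHermitian_coe P
    rw [hA.rank_eq_card_non_zero_eigs, Fintype.card_eq_one_iff] at hr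
    obtain ⟨⟨i, hi⟩, hu⟩ := hr
    have h0 : ∀ j, j ≠ i → hA.eigenvalues j = 0 := by
      intro j hj
      by_contra h
      exact hj (congrArg Subtype.val (hu ⟨j, h⟩))
    have h1 : hA.eigenvalues i = 1 := by
      rw [hA.trace_eq_sum_eigenvalues, Finset.sum_eq_single i (fun j _ hj => by rw [h0 j hj]; simp)
        (by simp)] at ht
      exact Complex.ofReal_injective (by simpa using ht)
    refine ⟨v i, hv i, ?_⟩
    rw [hP, Finset.sum_eq_single i (fun j _ hj => by rw [h0 j hj]; simp) (by simp), h1, one_smul]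
  · rintro ⟨x, hx, rfl⟩
    have ht : (outerHerm x : Matrix ι ι ℂ).trace = 1 := by
      rw [coe_outerHerm, Matrix.trace_vecMulVec, hx]
    refine ⟨le_antisymm (Matrix.rank_vecMulVec_le _ _) ?_, ht⟩
    rw [Nat.one_le_iff_ne_zero]
    intro h
    have hA := isHermitian_coe (outerHerm x)
    rw [hA.rank_eq_card_non_zero_eigs, Fintype.card_eq_zero_iff] at h
    have h0 : ∀ i, hA.eigenvalues i = 0 := fun i => by
      by_contra hi
      exact h.elim ⟨i, hi⟩
    rw [hA.trace_eq_sum_eigenvalues] at ht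
    simp [h0] at ht

theorem outerHerm_mem_pureStates {x : ι → ℂ} (hx : x ⬝ᵥ star x = 1) :
    outerHerm x ∈ pureStates ι :=
  mem_pureStates_iff.2 ⟨x, hx, rfl⟩

theorem span_pureStates : Submodule.span ℝ (pureStates ι) = ⊤ := by
  rw [eq_top_iff]
  intro A _
  obtain ⟨v, hv, hA⟩ := exists_eq_sum_outerHerm A
  rw [hA]
  exact Submodule.sum_mem _ fun i _ =>
    Submodule.smul_mem _ _ (Submodule.subset_span (outerHerm_mem_pureStates (hv i)))

theorem trace_mul_self_of_mem_pureStates {P : Herm ι} (hP : P ∈ pureStates ι) :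
    ((P : Matrix ι ι ℂ) * (P : Matrix ι ι ℂ)).trace = 1 := by
  obtain ⟨x, hx, rfl⟩ := mem_pureStates_iff.1 hP
  rw [coe_outerHerm, Matrix.vecMulVec_mul_vecMulVec, dotProduct_comm, hx,
    one_smul, Matrix.trace_vecMulVec, hx]

end PureStates

/-! ### Tensor products of matrices -/

/-- Coordinates are freed one at a time: the induction is on the set `t` of coordinates where `m` is
arbitrary. -/
theorem MultilinearMap.mem_of_span_eq_top {R ι N : Type*} [CommRing R] [Fintype ι] [DecidableEq ι]
    {M : ι → Type*} [∀ i, AddCommGroup (M i)] [∀ i, Module R (M i)] [AddCommGroup N] [Module R N]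
    (f : MultilinearMap R M N) (s : (i : ι) → Set (M i))
    (hs : ∀ i, Submodule.span R (s i) = ⊤) (W : Submodule R N)
    (h : ∀ m : (i : ι) → M i, (∀ i, m i ∈ s i) → f m ∈ W) (m : (i : ι) → M i) : f m ∈ W := by
  have key : ∀ t : Finset ι, ∀ m : (i : ι) → M i, (∀ i, i ∉ t → m i ∈ s i) → f m ∈ W := by
    intro t
    induction t using Finset.induction_on with
    | empty => exact fun m hm => h m fun i => hm i (by simp)
    | insert i t _ ih =>
      intro m hm
      have hle : Submodule.span R (s i) ≤ W.comap (f.toLinearMap m i) := by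
        rw [Submodule.span_le]
        intro x hx
        refine ih _ fun j hj => ?_
        by_cases hji : j = i
        · subst hji; simpa using hx
        · rw [Function.update_of_ne hji]
          exact hm j (by simp [hji, hj])
      have := hle (by rw [hs i]; trivial : m i ∈ Submodule.span R (s i))
      simpa using this
  exact key Finset.univ m (by simp)

section Tensor

variable {k : ℕ} {n : Fin k → ℕ}

/-- The Kronecker product of a family of complex matrices, as a multilinear map. -/
def tensorMatrix (n : Fin k → ℕ) :
    MultilinearMap ℂ (fun i => Matrix (Fin (n i)) (Fin (n i)) ℂ)
      (Matrix (ProdIdx n) (ProdIdx n) ℂ) where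
  toFun B := Matrix.of fun a b => ∏ i, B i (a i) (b i)
  map_update_add' B i X Y := by
    ext a b
    simp only [Matrix.of_apply, Matrix.add_apply]
    rw [← Finset.mul_prod_erase _ _ (Finset.mem_univ i), ← Finset.mul_prod_erase _ _
      (Finset.mem_univ i), ← Finset.mul_prod_erase _ _ (Finset.mem_univ i)]
    simp only [Function.update_self, Matrix.add_apply, add_mul]
    congr 1 <;> congr 1 <;> refine Finset.prod_congr rfl fun j hj => ?_ <;>
      rw [Function.update_of_ne (Finset.ne_of_mem_erase hj),
        Function.update_of_ne (Finset.ne_of_mem_erase hj)]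
  map_update_smul' B i c X := by
    ext a b
    simp only [Matrix.of_apply, Matrix.smul_apply]
    rw [← Finset.mul_prod_erase _ _ (Finset.mem_univ i), ← Finset.mul_prod_erase _ _
      (Finset.mem_univ i)]
    simp only [Function.update_self, Matrix.smul_apply, smul_eq_mul, mul_assoc]
    congr 2; refine Finset.prod_congr rfl fun j hj => ?_
    rw [Function.update_of_ne (Finset.ne_of_mem_erase hj),
        Function.update_of_ne (Finset.ne_of_mem_erase hj)]

theorem tensorMatrix_apply (B : (i : Fin k) → Matrix (Fin (n i)) (Fin (n i)) ℂ)
    (a b : ProdIdx n) : tensorMatrix n B a b = ∏ i, B i (a i) (b i) := rfl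

theorem coe_tensorHerm (A : (i : Fin k) → Herm (Fin (n i))) :
    (tensorHerm A : Matrix (ProdIdx n) (ProdIdx n) ℂ) =
      tensorMatrix n fun i => (A i : Matrix (Fin (n i)) (Fin (n i)) ℂ) := rfl

theorem coe_update (A : (i : Fin k) → Herm (Fin (n i))) (i : Fin k) (X : Herm (Fin (n i))) :
    (fun j => (Function.update A i X j : Matrix (Fin (n j)) (Fin (n j)) ℂ)) =
      Function.update (fun j => (A j : Matrix (Fin (n j)) (Fin (n j)) ℂ)) i X := by
  funext j
  by_cases hj : j = i
  · subst hj; simp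
  · simp [Function.update_of_ne hj]

/-- `tensorHerm` as a real-multilinear map. -/
def tensorHermMap (n : Fin k → ℕ) :
    MultilinearMap ℝ (fun i => Herm (Fin (n i))) (Herm (ProdIdx n)) where
  toFun A := tensorHerm A
  map_update_add' A i X Y := by
    -- The field quantifies over every `DecidableEq` instance; it is identified with the standard
    -- one so that `coe_update` applies.
    rename_i inst
    obtain rfl : inst = instDecidableEqFin k := Subsingleton.elim _ _
    apply Subtype.ext
    rw [AddSubgroup.coe_add, coe_tensorHerm, coe_tensorHerm, coe_tensorHerm]
    simp only [coe_update, AddSubgroup.coe_add, MultilinearMap.map_update_add]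
  map_update_smul' A i c X := by
    rename_i inst
    obtain rfl : inst = instDecidableEqFin k := Subsingleton.elim _ _
    apply Subtype.ext
    rw [selfAdjoint.val_smul, coe_tensorHerm, coe_tensorHerm]
    simp only [coe_update, selfAdjoint.val_smul]
    rw [← Complex.coe_smul, MultilinearMap.map_update_smul, Complex.coe_smul]

theorem tensorHermMap_apply (A : (i : Fin k) → Herm (Fin (n i))) :
    tensorHermMap n A = tensorHerm A := rfl

theorem trace_tensorMatrix_mul (A B : (i : Fin k) → Matrix (Fin (n i)) (Fin (n i)) ℂ) :
    (tensorMatrix n A * tensorMatrix n B).trace = ∏ i, (A i * B i).trace := by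
  simp only [Matrix.trace, Matrix.diag_apply, Matrix.mul_apply, tensorMatrix_apply]
  rw [Fintype.prod_sum]
  refine Finset.sum_congr rfl fun a _ => ?_
  rw [Fintype.prod_sum]
  refine Finset.sum_congr rfl fun b _ => ?_
  rw [Finset.prod_mul_distrib]

theorem span_coe_pureStates {ι : Type} [Fintype ι] [DecidableEq ι] :
    Submodule.span ℂ ((fun P : Herm ι => (P : Matrix ι ι ℂ)) '' pureStates ι) = ⊤ := by
  have h : ∀ A : Herm ι, (A : Matrix ι ι ℂ) ∈
      Submodule.span ℂ ((fun P : Herm ι => (P : Matrix ι ι ℂ)) '' pureStates ι) := by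
    intro A
    have hA : A ∈ Submodule.span ℝ (pureStates ι) := by rw [span_pureStates]; trivial
    induction hA using Submodule.span_induction with
    | mem x hx => exact Submodule.subset_span ⟨x, hx, rfl⟩
    | zero => simp
    | add x y _ _ hx hy => exact Submodule.add_mem _ hx hy
    | smul c x _ hx =>
      rw [selfAdjoint.val_smul, ← Complex.coe_smul]
      exact Submodule.smul_mem _ _ hx
  rw [eq_top_iff]
  intro M _
  rw [← realPart_add_I_smul_imaginaryPart M]
  exact Submodule.add_mem _ (h _) (Submodule.smul_mem _ _ (h _))

/-- Matrices whose real and imaginary parts lie in the real span form a complex subspace `WC`. By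
complex multilinearity it contains every Kronecker product, in particular all matrix units, so it is
everything. -/
theorem span_productPureStates : Submodule.span ℝ (productPureStates n) = ⊤ := by
  set W := Submodule.span ℝ (productPureStates n)
  let WC : Submodule ℂ (Matrix (ProdIdx n) (ProdIdx n) ℂ) :=
    { carrier := {M | realPart M ∈ W ∧ imaginaryPart M ∈ W}
      zero_mem' := by simp
      add_mem' := fun {x y} hx hy => by
        simp only [Set.mem_ofPred_eq, map_add]
        exact ⟨W.add_mem hx.1 hy.1, W.add_mem hx.2 hy.2⟩
      smul_mem' := fun c x hx => by
        simp only [Set.mem_ofPred_eq, realPart_smul, imaginaryPart_smul]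
        exact ⟨W.sub_mem (W.smul_mem _ hx.1) (W.smul_mem _ hx.2),
          W.add_mem (W.smul_mem _ hx.2) (W.smul_mem _ hx.1)⟩ }
  have h1 : ∀ B, tensorMatrix n B ∈ WC := by
    refine (tensorMatrix n).mem_of_span_eq_top _ (fun i => span_coe_pureStates) WC ?_
    intro m hm
    choose P hP hPm using hm
    have : tensorMatrix n m = (tensorHerm P : Matrix (ProdIdx n) (ProdIdx n) ℂ) := by
      rw [coe_tensorHerm]
      exact congrArg _ (funext fun i => (hPm i).symm)
    rw [this]
    refine ⟨?_, ?_⟩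
    · rw [selfAdjoint.realPart_coe]
      exact Submodule.subset_span ⟨P, hP, rfl⟩
    · rw [selfAdjoint.imaginaryPart_coe]
      exact W.zero_mem
  have h2 : ∀ M, M ∈ WC := by
    intro M
    rw [Matrix.matrix_eq_sum_single M]
    refine Submodule.sum_mem _ fun a _ => Submodule.sum_mem _ fun b _ => ?_
    have : Matrix.single a b (M a b) =
        M a b • tensorMatrix n fun i => Matrix.single (a i) (b i) 1 := by
      ext c d
      rw [Matrix.smul_apply, tensorMatrix_apply]
      simp only [Matrix.single_apply]
      rw [Finset.prod_ite_zero]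
      simp [funext_iff, forall_and]
    rw [this]
    exact WC.smul_mem _ (h1 _)
  rw [eq_top_iff]
  intro A _
  have := (h2 (A : Matrix (ProdIdx n) (ProdIdx n) ℂ)).1
  rwa [selfAdjoint.realPart_coe] at this

end Tensor

/-! ### Sums of two product pure states -/

section Rigidity

variable {ι κ : Type} [Fintype ι] [DecidableEq ι] [Fintype κ] [DecidableEq κ]

open scoped ComplexOrder in
theorem eq_zero_of_trace_mul_self {D : Herm ι}
    (h : ((D : Matrix ι ι ℂ) * (D : Matrix ι ι ℂ)).trace = 0) : D = 0 := by
  apply Subtype.ext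
  have h' : ((D : Matrix ι ι ℂ)ᴴ * (D : Matrix ι ι ℂ)).trace = 0 := by
    rwa [(isHermitian_coe D).eq]
  exact Matrix.trace_conjTranspose_mul_self_eq_zero_iff.1 h'

/-- The parallelogram law with unit Frobenius norms: the sum of two pure states determines the
length of their difference. -/
theorem trace_parallelogram {P Q : Herm ι} (hP : P ∈ pureStates ι) (hQ : Q ∈ pureStates ι) :
    (((P - Q : Herm ι) : Matrix ι ι ℂ) * ((P - Q : Herm ι) : Matrix ι ι ℂ)).trace =
      4 - (((P + Q : Herm ι) : Matrix ι ι ℂ) * ((P + Q : Herm ι) : Matrix ι ι ℂ)).trace := by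
  have h1 := trace_mul_self_of_mem_pureStates hP
  have h2 := trace_mul_self_of_mem_pureStates hQ
  simp only [AddSubgroup.coe_add, AddSubgroup.coe_sub, mul_add, add_mul, mul_sub, sub_mul,
    Matrix.trace_add, Matrix.trace_sub]
  linear_combination 2 * h1 + 2 * h2

theorem eq_of_add_self_eq_add {P R R' : Herm ι} (hP : P ∈ pureStates ι) (hR : R ∈ pureStates ι)
    (hR' : R' ∈ pureStates ι) (h : P + P = R + R') : R = P := by
  have h1 := trace_parallelogram hP hP
  have h2 := trace_parallelogram hR hR'
  rw [← h, ← h1, sub_self] at h2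
  have h3 := eq_zero_of_trace_mul_self (h2.trans (by simp))
  rw [sub_eq_zero] at h3
  subst h3
  apply Subtype.ext
  have := congrArg (fun X : Herm ι => (X : Matrix ι ι ℂ)) h
  ext a b
  have h4 := congrFun (congrFun this a) b
  simp only [AddSubgroup.coe_add, Matrix.add_apply] at h4
  linear_combination (-1 / 2 : ℂ) * h4

theorem eq_of_add_eq_of_sub_eq {P Q R R' : Herm ι} (h : P + Q = R + R') (h' : P - Q = R - R') :
    R = P := by
  apply Subtype.ext
  ext a b
  have h1 := congrFun (congrFun (congrArg (fun X : Herm ι => (X : Matrix ι ι ℂ)) h) a) b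
  have h2 := congrFun (congrFun (congrArg (fun X : Herm ι => (X : Matrix ι ι ℂ)) h') a) b
  simp only [AddSubgroup.coe_add, AddSubgroup.coe_sub, Matrix.add_apply, Matrix.sub_apply] at h1 h2
  linear_combination (-1 / 2 : ℂ) * (h1 + h2)

theorem eq_of_forall_trace_mul {A B : Herm ι}
    (h : ∀ X : Matrix ι ι ℂ, ((A : Matrix ι ι ℂ) * X).trace = ((B : Matrix ι ι ℂ) * X).trace) :
    A = B :=
  Subtype.ext (Matrix.ext_iff_trace_mul_right.2 h)

/-- If `P ⊗ p + Q ⊗ q = R ⊗ r + R' ⊗ r'` with all factors pure, `P ≠ Q` and `p ≠ q`, then the two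
sums have the same terms. -/
theorem eq_or_eq_of_bipartite {P Q R R' : Herm ι} {p q r r' : Herm κ}
    (hP : P ∈ pureStates ι) (hQ : Q ∈ pureStates ι) (hR : R ∈ pureStates ι)
    (hR' : R' ∈ pureStates ι) (hPQ : P ≠ Q) (hpq : p ≠ q)
    (hs : P + Q = R + R') (hs' : p + q = r + r')
    (ht : ∀ (X : Matrix ι ι ℂ) (Y : Matrix κ κ ℂ),
      (P * X).trace * (p * Y).trace + (Q * X).trace * (q * Y).trace =
        (R * X).trace * (r * Y).trace + (R' * X).trace * (r' * Y).trace) :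
    (R = P ∧ r = p) ∨ (R = Q ∧ r = q) := by
  have hD : P - Q ≠ 0 := sub_ne_zero.2 hPQ
  have hd : p - q ≠ 0 := sub_ne_zero.2 hpq
  have hnn : (((P - Q : Herm ι) : Matrix ι ι ℂ) * (P - Q : Herm ι)).trace =
      (((R - R' : Herm ι) : Matrix ι ι ℂ) * (R - R' : Herm ι)).trace := by
    rw [trace_parallelogram hP hQ, trace_parallelogram hR hR', hs]
  -- From `2(P⊗p + Q⊗q) = (P+Q)⊗(p+q) + (P-Q)⊗(p-q)` and equal marginals follows `(P-Q)⊗(p-q) =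
  -- (R-R')⊗(r-r')`.
  have hprod : ∀ (X : Matrix ι ι ℂ) (Y : Matrix κ κ ℂ),
      (((P - Q : Herm ι) : Matrix ι ι ℂ) * X).trace *
        (((p - q : Herm κ) : Matrix κ κ ℂ) * Y).trace =
      (((R - R' : Herm ι) : Matrix ι ι ℂ) * X).trace *
        (((r - r' : Herm κ) : Matrix κ κ ℂ) * Y).trace := by
    intro X Y
    have h1 := congrArg (fun Z : Herm ι => ((Z : Matrix ι ι ℂ) * X).trace) hs
    have h2 := congrArg (fun Z : Herm κ => ((Z : Matrix κ κ ℂ) * Y).trace) hs'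
    have h3 := ht X Y
    simp only [AddSubgroup.coe_add, AddSubgroup.coe_sub, add_mul, sub_mul,
      Matrix.trace_add, Matrix.trace_sub] at h1 h2 ⊢
    linear_combination 2 * h3 - h1 * ((p * Y).trace + (q * Y).trace) -
      h2 * ((R * X).trace + (R' * X).trace)
  generalize hDdef : P - Q = D at *
  generalize hEdef : R - R' = E at *
  generalize hddef : p - q = d at *
  generalize hedef : r - r' = e at *
  have hDD : ((D : Matrix ι ι ℂ) * (D : Matrix ι ι ℂ)).trace ≠ 0 :=
    fun h => hD (eq_zero_of_trace_mul_self h)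
  have hdd : ((d : Matrix κ κ ℂ) * (d : Matrix κ κ ℂ)).trace ≠ 0 :=
    fun h => hd (eq_zero_of_trace_mul_self h)
  set c := ((d : Matrix κ κ ℂ) * (d : Matrix κ κ ℂ)).trace with hc
  set c' := ((e : Matrix κ κ ℂ) * (d : Matrix κ κ ℂ)).trace with hc'
  have hDE : ∀ X : Matrix ι ι ℂ,
      ((D : Matrix ι ι ℂ) * X).trace * c = ((E : Matrix ι ι ℂ) * X).trace * c' :=
    fun X => hprod X d
  -- Since `D` and `E` have equal norm, pairing with both leaves only `E = ±D`; then `e = ±d` with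
  -- the same sign.
  have hsq : c ^ 2 = c' ^ 2 := by
    have h1 := hDE D
    have h2 := hDE E
    rw [Matrix.trace_mul_comm] at h2
    apply mul_left_cancel₀ hDD
    rw [← hnn] at h2
    linear_combination c * h1 + c' * h2
  rcases sq_eq_sq_iff_eq_or_eq_neg.1 hsq with h | h
  · left
    rw [h] at hDE hdd
    have h1 : D = E := eq_of_forall_trace_mul fun X => mul_right_cancel₀ hdd (hDE X)
    have h2 : d = e := eq_of_forall_trace_mul fun Y =>
      mul_left_cancel₀ hDD (by rw [hprod D Y, h1])
    exact ⟨eq_of_add_eq_of_sub_eq hs (by rw [hDdef, hEdef, h1]),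
      eq_of_add_eq_of_sub_eq hs' (by rw [hddef, hedef, h2])⟩
  · right
    have hc0 : c' ≠ 0 := by
      intro h0; rw [h, h0, neg_zero] at hdd; exact hdd rfl
    have h1 : -D = E := eq_of_forall_trace_mul fun X => by
      have := hDE X
      rw [h] at this
      apply mul_right_cancel₀ hc0
      rw [AddSubgroup.coe_neg, neg_mul, Matrix.trace_neg]
      linear_combination this
    have h2 : -d = e := eq_of_forall_trace_mul fun Y => by
      have := hprod D Y
      rw [← h1, AddSubgroup.coe_neg, neg_mul, Matrix.trace_neg] at this
      apply mul_left_cancel₀ hDD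
      rw [AddSubgroup.coe_neg, neg_mul, Matrix.trace_neg]
      linear_combination - this
    exact ⟨eq_of_add_eq_of_sub_eq (by rw [add_comm, hs]) (by rw [hEdef, ← h1, ← hDdef, neg_sub]),
      eq_of_add_eq_of_sub_eq (by rw [add_comm, hs']) (by rw [hedef, ← h2, ← hddef, neg_sub])⟩

/-- Changing the phase of `y` leaves its projection unchanged but can make the inner product with
`x` purely imaginary, so that `x + w` and `x - w` have equal length when `x` is a unit vector too.
-/
theorem exists_phase {x y : ι → ℂ} (hy : y ⬝ᵥ star y = 1) :
    ∃ w : ι → ℂ, w ⬝ᵥ star w = 1 ∧ outerHerm w = outerHerm y ∧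
      x ⬝ᵥ star w + w ⬝ᵥ star x = 0 := by
  obtain ⟨η, hη, hre⟩ : ∃ η : ℂ, η * star η = 1 ∧
      star η * (x ⬝ᵥ star y) + η * star (x ⬝ᵥ star y) = 0 := by
    generalize x ⬝ᵥ star y = c
    by_cases hc : c = 0
    · exact ⟨1, by simp, by simp [hc]⟩
    · have hc' : (‖c‖ : ℂ) ≠ 0 := by simpa using hc
      have hcc : c * star c = (‖c‖ : ℂ) ^ 2 := by
        rw [Complex.star_def, Complex.mul_conj']
      refine ⟨Complex.I * c / ‖c‖, ?_, ?_⟩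
      · simp only [star_div₀, star_mul', Complex.star_def, Complex.conj_I, Complex.conj_ofReal]
        rw [Complex.star_def] at hcc
        field_simp
        linear_combination (-Complex.I ^ 2) * hcc - (‖c‖ : ℂ) ^ 2 * Complex.I_sq
      · simp only [star_div₀, star_mul', Complex.star_def, Complex.conj_I, Complex.conj_ofReal]
        ring
  have hyx : y ⬝ᵥ star x = star (x ⬝ᵥ star y) := by
    simp [dotProduct, mul_comm]
  refine ⟨η • y, ?_, ?_, ?_⟩
  · rw [star_smul, smul_dotProduct, dotProduct_smul, hy, smul_eq_mul, smul_eq_mul, mul_one, hη]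
  · apply Subtype.ext
    rw [coe_outerHerm, coe_outerHerm, star_smul, Matrix.smul_vecMulVec, Matrix.vecMulVec_smul,
      smul_smul, hη, one_smul]
  · rw [star_smul, smul_dotProduct, dotProduct_smul, hyx, smul_eq_mul, smul_eq_mul, hre]

/-- The sum of two distinct pure states is a sum of two other pure states. -/
theorem exists_add_eq_add {P Q : Herm ι} (hP : P ∈ pureStates ι) (hQ : Q ∈ pureStates ι)
    (hPQ : P ≠ Q) : ∃ R ∈ pureStates ι, ∃ R' ∈ pureStates ι, R ≠ P ∧ R ≠ Q ∧ P + Q = R + R' := by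
  obtain ⟨x, hx, rfl⟩ := mem_pureStates_iff.1 hP
  obtain ⟨y, hy, rfl⟩ := mem_pureStates_iff.1 hQ
  obtain ⟨w, hw, hwy, hxw⟩ := exists_phase (x := x) hy
  rw [← hwy] at hQ hPQ ⊢
  obtain ⟨s, hs⟩ : ∃ s : ℂ, s * star s = 1 / 2 := by
    refine ⟨((√(1 / 2) : ℝ) : ℂ), ?_⟩
    rw [Complex.star_def, Complex.conj_ofReal, ← Complex.ofReal_mul,
      Real.mul_self_sqrt (by norm_num)]
    norm_num
  -- Both `x ± w` have squared length two, so `s` normalizes them; the cross terms cancel in the sum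
  -- of their projections.
  have hR : outerHerm (s • (x + w)) ∈ pureStates ι := by
    apply outerHerm_mem_pureStates
    rw [star_smul, smul_dotProduct, dotProduct_smul, star_add, add_dotProduct, dotProduct_add,
      dotProduct_add, hx, hw, smul_eq_mul, smul_eq_mul]
    linear_combination 2 * hs + s * star s * hxw
  have hR' : outerHerm (s • (x - w)) ∈ pureStates ι := by
    apply outerHerm_mem_pureStates
    rw [star_smul, smul_dotProduct, dotProduct_smul, star_sub, sub_dotProduct, dotProduct_sub,
      dotProduct_sub, hx, hw, smul_eq_mul, smul_eq_mul]
    linear_combination 2 * hs - s * star s * hxw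
  have hsum : outerHerm x + outerHerm w = outerHerm (s • (x + w)) + outerHerm (s • (x - w)) := by
    apply Subtype.ext
    ext a b
    simp only [AddSubgroup.coe_add, Matrix.add_apply, outerHerm_apply, Pi.smul_apply, Pi.add_apply,
      Pi.sub_apply, smul_eq_mul, star_mul', star_add, star_sub]
    linear_combination (-2 * (x a * star (x b) + w a * star (w b))) * hs
  have hdiff : ((outerHerm (s • (x + w)) - outerHerm (s • (x - w)) : Herm ι) : Matrix ι ι ℂ) =
      Matrix.vecMulVec x (star w) + Matrix.vecMulVec w (star x) := by
    ext a b
    simp only [AddSubgroup.coe_sub, Matrix.add_apply, Matrix.sub_apply, outerHerm_apply,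
      Pi.smul_apply, Pi.add_apply, Matrix.vecMulVec_apply, Pi.star_apply,
      Pi.sub_apply, smul_eq_mul, star_mul', star_add, star_sub]
    linear_combination (2 * (x a * star (w b) + w a * star (x b))) * hs
  -- If `R` were `P` or `Q`, then `R - R'` would be `±(P - Q)`, hence orthogonal to itself, forcing
  -- `P = Q`.
  have horth : (((outerHerm (s • (x + w)) - outerHerm (s • (x - w)) : Herm ι) : Matrix ι ι ℂ) *
      ((outerHerm x - outerHerm w : Herm ι) : Matrix ι ι ℂ)).trace = 0 := by
    rw [hdiff, AddSubgroup.coe_sub, coe_outerHerm, coe_outerHerm]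
    simp only [add_mul, mul_sub, Matrix.vecMulVec_mul_vecMulVec, Matrix.trace_add,
      Matrix.trace_sub, Matrix.trace_vecMulVec, dotProduct_smul, smul_eq_mul]
    rw [dotProduct_comm (star w) x, dotProduct_comm (star w) w, dotProduct_comm (star x) x,
      dotProduct_comm (star x) w, hx, hw]
    ring
  refine ⟨_, hR, _, hR', fun h => hPQ ?_, fun h => hPQ ?_, hsum⟩
  · rw [h] at hsum horth
    rw [← add_left_cancel hsum] at horth
    exact sub_eq_zero.1 (eq_zero_of_trace_mul_self horth)
  · rw [h] at hsum horth
    rw [add_comm] at hsum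
    rw [← add_left_cancel hsum] at horth
    rw [← neg_sub, AddSubgroup.coe_neg, neg_mul, Matrix.trace_neg, neg_eq_zero] at horth
    exact sub_eq_zero.1 (eq_zero_of_trace_mul_self horth)

end Rigidity

/-! ### Automorphisms of Hamming graphs -/

section Hamming

variable {ι : Type} {V : ι → Type}

/-- `p` and `q` differ at the coordinate `i` and nowhere else. -/
def DiffersOnlyAt (i : ι) (p q : (i : ι) → V i) : Prop :=
  p i ≠ q i ∧ ∀ j, j ≠ i → p j = q j

/-- Adjacency in the Hamming graph: `p` and `q` differ at exactly one coordinate. -/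
def HammingAdj (p q : (i : ι) → V i) : Prop := ∃ i, DiffersOnlyAt i p q

theorem DiffersOnlyAt.symm {i : ι} {p q : (i : ι) → V i} (h : DiffersOnlyAt i p q) :
    DiffersOnlyAt i q p :=
  ⟨h.1.symm, fun j hj => (h.2 j hj).symm⟩

theorem DiffersOnlyAt.eq_index {i j : ι} {p q : (i : ι) → V i} (h : DiffersOnlyAt i p q)
    (h' : DiffersOnlyAt j p q) : i = j := by
  by_contra hij
  exact h.1 (h'.2 i hij)

theorem DiffersOnlyAt.trans {i : ι} {p q r : (i : ι) → V i} (h : DiffersOnlyAt i p q)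
    (h' : DiffersOnlyAt i q r) (hne : p ≠ r) : DiffersOnlyAt i p r := by
  have h0 : ∀ j, j ≠ i → p j = r j := fun j hj => (h.2 j hj).trans (h'.2 j hj)
  refine ⟨fun he => hne (funext fun j => ?_), h0⟩
  by_cases hj : j = i
  · subst hj; exact he
  · exact h0 j hj

/-- With distinct directions, `q` and `r` would differ at both `i` and `j` and not be adjacent. -/
theorem DiffersOnlyAt.eq_of_triangle {i j : ι} {p q r : (i : ι) → V i}
    (hpq : DiffersOnlyAt i p q) (hpr : DiffersOnlyAt j p r) (hqr : HammingAdj q r) : i = j := by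
  by_contra hij
  obtain ⟨l, hl⟩ := hqr
  have hi : q i ≠ r i := by
    rw [← hpr.2 i hij]; exact hpq.1.symm
  have hj : q j ≠ r j := by
    rw [← hpq.2 j (Ne.symm hij)]; exact hpr.1
  have h1 : i = l := by
    by_contra h; exact hi (hl.2 i h)
  have h2 : j = l := by
    by_contra h; exact hj (hl.2 j h)
  exact hij (h1.trans h2.symm)

/-- Opposite sides of an induced square have the same direction. -/
theorem DiffersOnlyAt.of_square {i : ι} {a b c d : (i : ι) → V i}
    (hab : DiffersOnlyAt i a b) (hbc : HammingAdj b c) (hcd : HammingAdj d c)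
    (had : HammingAdj a d) (hac : ¬ HammingAdj a c) (hbd : ¬ HammingAdj b d)
    (hac' : a ≠ c) (hbd' : b ≠ d) : DiffersOnlyAt i d c := by
  obtain ⟨m, hm⟩ := hbc
  obtain ⟨l, hl⟩ := hcd
  obtain ⟨j, hj⟩ := had
  have hij : i ≠ j := by
    rintro rfl
    exact hbd ⟨i, hab.symm.trans hj hbd'⟩
  have him : i ≠ m := by
    rintro rfl
    exact hac ⟨i, hab.trans hm hac'⟩
  -- The corners `a` and `c` differ at `i`, while `a` and `d` agree there, so the edge from `d` to
  -- `c` must change `i`.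
  have hi : a i ≠ c i := by rw [← hm.2 i him]; exact hab.1
  have hil : i = l := by
    by_contra h
    exact hi ((hj.2 i hij).trans (hl.2 i h))
  exact hil ▸ hl

theorem differsOnlyAt_update [DecidableEq ι] (p : (i : ι) → V i) {i : ι} {x : V i}
    (hx : p i ≠ x) : DiffersOnlyAt i p (Function.update p i x) := by
  refine ⟨by simpa using hx, fun j hj => ?_⟩
  rw [Function.update_of_ne hj]

theorem exists_differsOnlyAt [DecidableEq ι] [∀ i, Nontrivial (V i)]
    (p : (i : ι) → V i) (i : ι) :
    ∃ q, DiffersOnlyAt i p q := by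
  obtain ⟨x, hx⟩ := exists_ne (p i)
  exact ⟨_, differsOnlyAt_update p hx.symm⟩

variable [Fintype ι] [DecidableEq ι]

/-- A property that is stable under changing one coordinate holds everywhere if it holds
somewhere. -/
theorem forall_of_update (T : ((i : ι) → V i) → Prop) (p₀ : (i : ι) → V i) (h₀ : T p₀)
    (h : ∀ p i x, T p → T (Function.update p i x)) (p : (i : ι) → V i) : T p := by
  have key : ∀ s : Finset ι, T (s.piecewise p p₀) := by
    intro s
    induction s using Finset.induction_on with
    | empty => simpa using h₀
    | insert i s _ ih =>
      rw [Finset.piecewise_insert]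
      exact h _ _ _ ih
  simpa using key Finset.univ

variable [∀ i, Nontrivial (V i)]

/-- A Hamming graph automorphism sends all edges of one direction to edges of one direction. -/
theorem exists_direction_map (g : ((i : ι) → V i) ≃ ((i : ι) → V i))
    (hg : ∀ p q, HammingAdj (g p) (g q) ↔ HammingAdj p q) (i : ι) :
    ∃ j, ∀ p q, DiffersOnlyAt i p q → DiffersOnlyAt j (g p) (g q) := by
  have p₀ : (i : ι) → V i := fun i => Classical.arbitrary _
  obtain ⟨q₀, hq₀⟩ := exists_differsOnlyAt p₀ i
  obtain ⟨j, hj⟩ := (hg _ _).2 ⟨i, hq₀⟩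
  -- Two edges of direction `i` at one vertex lie in a triangle, so their images share a direction.
  have star : ∀ p q r, DiffersOnlyAt i p q → DiffersOnlyAt j (g p) (g q) →
      DiffersOnlyAt i p r → DiffersOnlyAt j (g p) (g r) := by
    intro p q r hpq hgpq hpr
    by_cases hqr : q = r
    · rwa [← hqr]
    obtain ⟨l, hl⟩ := (hg _ _).2 ⟨i, hpr⟩
    have := hgpq.eq_of_triangle hl ((hg _ _).2 ⟨i, hpq.symm.trans hpr hqr⟩)
    exact this ▸ hl
  refine ⟨j, fun p => ?_⟩
  refine forall_of_update (fun p => ∀ q, DiffersOnlyAt i p q → DiffersOnlyAt j (g p) (g q)) p₀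
    (fun q hq => star p₀ q₀ q hq₀ hj hq) (fun p l x hp q hq => ?_) p
  by_cases hx : p l = x
  · rw [← hx, Function.update_eq_self] at hq ⊢
    exact hp q hq
  have hpl := differsOnlyAt_update p hx
  by_cases hl : l = i
  · subst hl
    exact star _ p q hpl.symm (hp _ hpl).symm hq
  -- For `l ≠ i` the induced square `p, r, r', p'` transports the image direction from `p` to `p'`.
  obtain ⟨r, hr⟩ := exists_differsOnlyAt p i
  set p' := Function.update p l x with hp'
  set r' := Function.update r l x with hr'
  have hrl : r l = p l := (hr.2 l hl).symm
  have hrr' : DiffersOnlyAt l r r' := differsOnlyAt_update r (by rwa [hrl])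
  have hpr' : DiffersOnlyAt i p' r' := by
    refine ⟨?_, fun m hm => ?_⟩
    · rw [hp', hr', Function.update_of_ne (Ne.symm hl), Function.update_of_ne (Ne.symm hl)]
      exact hr.1
    · by_cases hml : m = l
      · subst hml; simp [hp', hr']
      · rw [hp', hr', Function.update_of_ne hml, Function.update_of_ne hml]
        exact hr.2 m hm
  have hd : ∀ a b : (i : ι) → V i, a i ≠ b i → a l ≠ b l → a ≠ b ∧ ¬ HammingAdj a b := by
    intro a b hi hl'
    refine ⟨fun h => hi (congrFun h i), ?_⟩
    rintro ⟨m, hm⟩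
    have h1 : i = m := by
      by_contra h; exact hi (hm.2 i h)
    have h2 : l = m := by
      by_contra h; exact hl' (hm.2 l h)
    exact hl (h2.trans h1.symm)
  have h1 := hd p r' (by rw [← hrr'.2 i (Ne.symm hl)]; exact hr.1)
    (by rw [← hrl]; exact hrr'.1)
  have h2 := hd r p' (by rw [← hpl.2 i (Ne.symm hl)]; exact hr.1.symm)
    (by rw [hrl]; exact hpl.1)
  have h3 : DiffersOnlyAt j (g p') (g r') :=
    (hp r hr).of_square ((hg _ _).2 ⟨l, hrr'⟩) ((hg _ _).2 ⟨i, hpr'⟩) ((hg _ _).2 ⟨l, hpl⟩)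
      (fun h => h1.2 ((hg _ _).1 h)) (fun h => h2.2 ((hg _ _).1 h))
      (fun h => h1.1 (g.injective h)) (fun h => h2.1 (g.injective h))
  exact star p' r' q hpr' h3 hq

/-- Automorphisms of a Hamming graph permute the coordinates and act on each of them. -/
theorem exists_perm_of_hammingAdj_iff (g : ((i : ι) → V i) ≃ ((i : ι) → V i))
    (hg : ∀ p q, HammingAdj (g p) (g q) ↔ HammingAdj p q) :
    ∃ (π : Equiv.Perm ι) (φ : (i : ι) → V (π i) → V i),
      ∀ p i, g p i = φ i (p (π i)) := by
  choose σ hσ using exists_direction_map g hg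
  choose τ hτ using exists_direction_map g.symm (fun p q => by
    rw [← hg, g.apply_symm_apply, g.apply_symm_apply])
  have p₀ : (i : ι) → V i := fun i => Classical.arbitrary _
  have hτσ : ∀ i, τ (σ i) = i := by
    intro i
    obtain ⟨q, hq⟩ := exists_differsOnlyAt p₀ i
    have := hτ _ _ _ (hσ i _ _ hq)
    rw [g.symm_apply_apply, g.symm_apply_apply] at this
    exact this.eq_index hq
  have hστ : ∀ i, σ (τ i) = i := by
    intro i
    obtain ⟨q, hq⟩ := exists_differsOnlyAt p₀ i
    have := hσ _ _ _ (hτ i _ _ hq)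
    rw [g.apply_symm_apply, g.apply_symm_apply] at this
    exact this.eq_index hq
  refine ⟨⟨τ, σ, hστ, hτσ⟩, fun i x => g (Function.update p₀ (τ i) x) i, fun p i => ?_⟩
  -- Changing a coordinate `l ≠ τ i` moves the image only in direction `σ l ≠ i`, so coordinate `i`
  -- of the image depends on coordinate `τ i` alone.
  have key := forall_of_update
    (fun r => g (Function.update r (τ i) (p (τ i))) i =
      g (Function.update p₀ (τ i) (p (τ i))) i) p₀ rfl (fun r l x hr => ?_) p
  · rwa [Function.update_eq_self] at key
  by_cases hl : l = τ i
  · subst hl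
    rwa [Function.update_idem]
  · rw [Function.update_comm hl, ← hr]
    set r' := Function.update r (τ i) (p (τ i))
    by_cases hx : r' l = x
    · rw [← hx, Function.update_eq_self]
    · refine ((hσ l _ _ (differsOnlyAt_update r' hx)).2 i ?_).symm
      rintro rfl
      exact hl (hτσ l).symm

end Hamming

/-! ### Adjacency of product pure states -/

section ProductStates

variable {k : ℕ} {n : Fin k → ℕ}

/-- Pairing against `X` in slot `i` and identities elsewhere reads off a marginal, since the other
factors contribute their traces. -/
theorem trace_tensorHerm_mul_update {P : (i : Fin k) → Herm (Fin (n i))} {i : Fin k}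
    (hP : ∀ j, j ≠ i → (P j : Matrix (Fin (n j)) (Fin (n j)) ℂ).trace = 1)
    (X : Matrix (Fin (n i)) (Fin (n i)) ℂ) :
    ((tensorHerm P : Matrix (ProdIdx n) (ProdIdx n) ℂ) *
      tensorMatrix n (Function.update 1 i X)).trace = (P i * X).trace := by
  rw [coe_tensorHerm, trace_tensorMatrix_mul, Finset.prod_eq_single i]
  · rw [Function.update_self]
  · intro j _ hj
    rw [Function.update_of_ne hj, Pi.one_apply, mul_one, hP j hj]
  · simp

theorem trace_tensorHerm_mul_update_update {P : (i : Fin k) → Herm (Fin (n i))}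
    (hP : ∀ i, P i ∈ pureStates (Fin (n i))) {i j : Fin k} (hij : i ≠ j)
    (X : Matrix (Fin (n i)) (Fin (n i)) ℂ) (Y : Matrix (Fin (n j)) (Fin (n j)) ℂ) :
    ((tensorHerm P : Matrix (ProdIdx n) (ProdIdx n) ℂ) *
      tensorMatrix n (Function.update (Function.update 1 j Y) i X)).trace =
      (P i * X).trace * (P j * Y).trace := by
  rw [coe_tensorHerm, trace_tensorMatrix_mul, Finset.prod_eq_mul i j hij]
  · rw [Function.update_self, Function.update_of_ne hij.symm, Function.update_self]
  · rintro l _ ⟨hi, hj⟩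
    rw [Function.update_of_ne hi, Function.update_of_ne hj, Pi.one_apply, mul_one, (hP l).2]
  · simp
  · simp

theorem tensorHerm_injOn {P Q : (i : Fin k) → Herm (Fin (n i))}
    (hP : ∀ i, P i ∈ pureStates (Fin (n i))) (hQ : ∀ i, Q i ∈ pureStates (Fin (n i)))
    (h : tensorHerm P = tensorHerm Q) : P = Q := by
  funext i
  refine eq_of_forall_trace_mul fun X => ?_
  rw [← trace_tensorHerm_mul_update (fun j _ => (hP j).2), h,
    trace_tensorHerm_mul_update (fun j _ => (hQ j).2)]

theorem factor_add_eq {P Q R R' : (i : Fin k) → Herm (Fin (n i))}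
    (hP : ∀ i, P i ∈ pureStates (Fin (n i))) (hQ : ∀ i, Q i ∈ pureStates (Fin (n i)))
    (hR : ∀ i, R i ∈ pureStates (Fin (n i))) (hR' : ∀ i, R' i ∈ pureStates (Fin (n i)))
    (h : tensorHerm P + tensorHerm Q = tensorHerm R + tensorHerm R') (i : Fin k) :
    P i + Q i = R i + R' i := by
  refine eq_of_forall_trace_mul fun X => ?_
  have := congrArg (fun T : Herm (ProdIdx n) =>
    ((T : Matrix (ProdIdx n) (ProdIdx n) ℂ) * tensorMatrix n (Function.update 1 i X)).trace) h
  simp only [AddSubgroup.coe_add, add_mul, Matrix.trace_add] at this ⊢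
  rwa [trace_tensorHerm_mul_update (fun j _ => (hP j).2),
    trace_tensorHerm_mul_update (fun j _ => (hQ j).2),
    trace_tensorHerm_mul_update (fun j _ => (hR j).2),
    trace_tensorHerm_mul_update (fun j _ => (hR' j).2)] at this

/-- The marginals on pairs `(i, l)` reduce this to the bipartite case. Factor `i` is the anchor:
whether `R i` is `P i` or `Q i` decides the same choice at each other factor where `P` and `Q`
differ. Where they agree, the equality case of the parallelogram law leaves no choice. -/
theorem eq_or_eq_of_tensorHerm_add {P Q R R' : (i : Fin k) → Herm (Fin (n i))}
    (hP : ∀ i, P i ∈ pureStates (Fin (n i))) (hQ : ∀ i, Q i ∈ pureStates (Fin (n i)))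
    (hR : ∀ i, R i ∈ pureStates (Fin (n i))) (hR' : ∀ i, R' i ∈ pureStates (Fin (n i)))
    (h : tensorHerm P + tensorHerm Q = tensorHerm R + tensorHerm R') {i j : Fin k} (hij : i ≠ j)
    (hi : P i ≠ Q i) (hj : P j ≠ Q j) : R = P ∨ R = Q := by
  have hsum := factor_add_eq hP hQ hR hR' h
  have hpair : ∀ l, l ≠ i → P l ≠ Q l → (R i = P i ∧ R l = P l) ∨ (R i = Q i ∧ R l = Q l) := by
    intro l hl hne
    refine eq_or_eq_of_bipartite (hP i) (hQ i) (hR i) (hR' i) hi hne (hsum i) (hsum l) ?_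
    intro X Y
    have := congrArg (fun T : Herm (ProdIdx n) => ((T : Matrix (ProdIdx n) (ProdIdx n) ℂ) *
      tensorMatrix n (Function.update (Function.update 1 l Y) i X)).trace) h
    simp only [AddSubgroup.coe_add, add_mul, Matrix.trace_add] at this
    rwa [trace_tensorHerm_mul_update_update hP hl.symm,
      trace_tensorHerm_mul_update_update hQ hl.symm,
      trace_tensorHerm_mul_update_update hR hl.symm,
      trace_tensorHerm_mul_update_update hR' hl.symm] at this
  have heq : ∀ l, P l = Q l → R l = P l := by
    intro l hl
    have := hsum l
    rw [← hl] at this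
    exact eq_of_add_self_eq_add (hP l) (hR l) (hR' l) this
  have hcase : R i = P i ∨ R i = Q i := by
    rcases hpair j hij.symm hj with h | h
    · exact Or.inl h.1
    · exact Or.inr h.1
  rcases hcase with hc | hc
  · left
    funext l
    by_cases hl : l = i
    · subst hl; exact hc
    by_cases hne : P l = Q l
    · exact heq l hne
    · rcases hpair l hl hne with h | h
      · exact h.2
      · exact absurd (hc.symm.trans h.1) hi
  · right
    funext l
    by_cases hl : l = i
    · subst hl; exact hc
    by_cases hne : P l = Q l
    · rw [heq l hne, hne]
    · rcases hpair l hl hne with h | h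
      · exact absurd (h.1.symm.trans hc) hi
      · exact h.2

/-- Distinct elements of `S` whose sum is also a sum of two other elements of `S`. -/
def SumsAgain {E : Type} [Add E] (S : Set E) (x y : E) : Prop :=
  x ≠ y ∧ ∃ r ∈ S, ∃ r' ∈ S, r ≠ x ∧ r ≠ y ∧ x + y = r + r'

theorem sumsAgain_image_iff {E : Type} [AddCommGroup E] [Module ℝ E] {S : Set E} {f : E →ₗ[ℝ] E}
    (hf : Function.Injective f) (hS : f '' S = S) (x y : E) :
    SumsAgain S (f x) (f y) ↔ SumsAgain S x y := by
  constructor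
  · rintro ⟨hxy, r, hr, r', hr', h1, h2, h3⟩
    rw [← hS] at hr hr'
    obtain ⟨r, hr, rfl⟩ := hr
    obtain ⟨r', hr', rfl⟩ := hr'
    refine ⟨fun h => hxy (by rw [h]), r, hr, r', hr', fun h => h1 (by rw [h]),
      fun h => h2 (by rw [h]), hf (by rw [map_add, map_add, h3])⟩
  · rintro ⟨hxy, r, hr, r', hr', h1, h2, h3⟩
    refine ⟨fun h => hxy (hf h), f r, ?_, f r', ?_, fun h => h1 (hf h), fun h => h2 (hf h), ?_⟩
    · rw [← hS]; exact ⟨r, hr, rfl⟩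
    · rw [← hS]; exact ⟨r', hr', rfl⟩
    · rw [← map_add, h3, map_add]

/-- The product pure state of a family of pure states. -/
def productState (p : (i : Fin k) → pureStates (Fin (n i))) : Herm (ProdIdx n) :=
  tensorHerm fun i => (p i : Herm (Fin (n i)))

theorem productState_mem (p : (i : Fin k) → pureStates (Fin (n i))) :
    productState p ∈ productPureStates n :=
  ⟨_, fun i => (p i).2, rfl⟩

theorem mem_productPureStates_iff {T : Herm (ProdIdx n)} :
    T ∈ productPureStates n ↔ ∃ p, productState p = T := by
  constructor
  · rintro ⟨P, hP, rfl⟩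
    exact ⟨fun i => ⟨P i, hP i⟩, rfl⟩
  · rintro ⟨p, rfl⟩
    exact productState_mem p

theorem productState_injective : Function.Injective (productState (n := n)) := by
  intro p q h
  have := tensorHerm_injOn (fun i => (p i).2) (fun i => (q i).2) h
  funext i
  exact Subtype.ext (congrFun this i)

/-- Two product pure states sum again exactly when they differ in one factor. -/
theorem sumsAgain_productState_iff (p q : (i : Fin k) → pureStates (Fin (n i))) :
    SumsAgain (productPureStates n) (productState p) (productState q) ↔ HammingAdj p q := by
  constructor
  · rintro ⟨hne, r, hr, r', hr', h1, h2, h3⟩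
    obtain ⟨r, rfl⟩ := mem_productPureStates_iff.1 hr
    obtain ⟨r', rfl⟩ := mem_productPureStates_iff.1 hr'
    obtain ⟨i, hi⟩ : ∃ i, p i ≠ q i := by
      by_contra hcon
      push Not at hcon
      exact hne (congrArg _ (funext hcon))
    refine ⟨i, hi, fun j hj => ?_⟩
    by_contra hne'
    rcases eq_or_eq_of_tensorHerm_add (fun i => (p i).2) (fun i => (q i).2) (fun i => (r i).2)
      (fun i => (r' i).2) h3 (Ne.symm hj) (fun h => hi (Subtype.ext h))
      (fun h => hne' (Subtype.ext h)) with h | h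
    · exact h1 (congrArg tensorHerm h)
    · exact h2 (congrArg tensorHerm h)
  · rintro ⟨i, hi, hj⟩
    obtain ⟨R, hR, R', hR', h1, h2, h3⟩ :=
      exists_add_eq_add (p i).2 (q i).2 (fun h => hi (Subtype.ext h))
    have hupd : ∀ X : pureStates (Fin (n i)),
        productState (Function.update p i X) =
          tensorHermMap n (Function.update (fun l => (p l : Herm (Fin (n l)))) i X) := by
      intro X
      rw [tensorHermMap_apply]
      refine congrArg tensorHerm (funext fun l => ?_)
      by_cases hl : l = i
      · subst hl; simp
      · simp [Function.update_of_ne hl]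
    have hp : p = Function.update p i (p i) := by simp
    have hq : q = Function.update p i (q i) := by
      funext l
      by_cases hl : l = i
      · subst hl; simp
      · rw [Function.update_of_ne hl, hj l hl]
    refine ⟨fun h => hi (congrFun (productState_injective h) i), _,
      productState_mem (Function.update p i ⟨R, hR⟩), _,
      productState_mem (Function.update p i ⟨R', hR'⟩), fun h => h1 ?_, fun h => h2 ?_, ?_⟩
    · have := congrFun (productState_injective h) i
      rw [Function.update_self] at this
      exact congrArg Subtype.val this
    · have := congrFun (productState_injective h) i
      rw [Function.update_self] at this
      exact congrArg Subtype.val this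
    · rw [hq]
      conv_lhs => rw [hp]
      rw [hupd, hupd, hupd]
      simp only [Function.update_idem]
      rw [hupd, ← MultilinearMap.map_update_add, ← MultilinearMap.map_update_add, h3]

/-- The partial trace over all tensor factors but the `j`-th. -/
def partialTrace (n : Fin k → ℕ) (j : Fin k) : Herm (ProdIdx n) →ₗ[ℝ] Herm (Fin (n j)) where
  -- The swapped indices in `single b a 1` come from `tr (M E_ba) = M_ab`.
  toFun T := ⟨Matrix.of fun a b => ((T : Matrix (ProdIdx n) (ProdIdx n) ℂ) *
      tensorMatrix n (Function.update 1 j (Matrix.single b a 1))).trace, by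
    rw [selfAdjoint.mem_iff]
    ext a b
    rw [Matrix.star_apply, Matrix.of_apply, Matrix.of_apply, ← Matrix.trace_conjTranspose,
      Matrix.conjTranspose_mul, (isHermitian_coe T).eq, Matrix.trace_mul_comm]
    congr 2
    ext c d
    rw [Matrix.conjTranspose_apply, tensorMatrix_apply, tensorMatrix_apply, star_prod]
    refine Finset.prod_congr rfl fun i _ => ?_
    by_cases hi : i = j
    · subst hi
      simp [Matrix.single_apply, apply_ite, and_comm]
    · rw [Function.update_of_ne hi, Function.update_of_ne hi]
      simp [Matrix.one_apply, apply_ite, eq_comm]⟩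
  map_add' S T := by
    apply Subtype.ext
    ext a b
    simp [add_mul]
  map_smul' c T := by
    apply Subtype.ext
    ext a b
    simp

theorem partialTrace_tensorHerm {P : (i : Fin k) → Herm (Fin (n i))} {j : Fin k}
    (hP : ∀ i, i ≠ j → (P i : Matrix (Fin (n i)) (Fin (n i)) ℂ).trace = 1) :
    partialTrace n j (tensorHerm P) = P j := by
  apply Subtype.ext
  ext a b
  change ((tensorHerm P : Matrix (ProdIdx n) (ProdIdx n) ℂ) *
      tensorMatrix n (Function.update 1 j (Matrix.single b a 1))).trace = _
  rw [trace_tensorHerm_mul_update hP]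
  simp [Matrix.trace_mul_single]

end ProductStates

open scoped ComplexConjugate

/-! ### Linear maps preserving pure states -/

section Minors

variable {κ : Type}

/-- All `2 × 2` minors of `M` vanish, that is, `M` has rank at most one. -/
def MinorsVanish (M : Matrix κ κ ℂ) : Prop :=
  ∀ a b c d, M a b * M c d = M a d * M c b

/-- The polarization of `MinorsVanish`. -/
def MinorsOrthogonal (M N : Matrix κ κ ℂ) : Prop :=
  ∀ a b c d, M a b * N c d + N a b * M c d = M a d * N c b + N a d * M c b

theorem minorsVanish_vecMulVec (x y : κ → ℂ) : MinorsVanish (Matrix.vecMulVec x y) := by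
  intro a b c d
  simp only [Matrix.vecMulVec_apply]
  ring

theorem MinorsVanish.exists_eq_vecMulVec {M : Matrix κ κ ℂ} (h : MinorsVanish M) :
    ∃ a b, M = Matrix.vecMulVec a b := by
  by_cases h0 : M = 0
  · exact ⟨0, 0, by simp [h0]⟩
  · obtain ⟨r, s, hrs⟩ : ∃ r s, M r s ≠ 0 := by
      by_contra hcon
      push Not at hcon
      exact h0 (Matrix.ext hcon)
    refine ⟨fun p => M p s / M r s, fun q => M r q, ?_⟩
    ext p q
    rw [Matrix.vecMulVec_apply]
    field_simp
    rw [h p q r s]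

theorem MinorsVanish.smul {M : Matrix κ κ ℂ} (h : MinorsVanish M) (z : ℂ) :
    MinorsVanish (z • M) := by
  intro a b c d
  simp only [Matrix.smul_apply, smul_eq_mul]
  linear_combination z ^ 2 * h a b c d

/-- On the unit circle a minor of the pencil is a Laurent polynomial in `z`. Averaging over the
fourth roots of unity with weight `z²` isolates the coefficients of `z²` and `z⁻²`, the minors of
`C` and `B`, which remain coupled. -/
theorem minor_add_minor_eq_zero {A B C D : Matrix κ κ ℂ}
    (h : ∀ z : ℂ, z * conj z = 1 → MinorsVanish (A + conj z • B + z • C + D)) (a b c d : κ) :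
    (B a b * B c d - B a d * B c b) + (C a b * C c d - C a d * C c b) = 0 := by
  have h1 := h 1 (by simp) a b c d
  have h2 := h (-1) (by simp) a b c d
  have h3 := h Complex.I (by simp) a b c d
  have h4 := h (-Complex.I) (by simp) a b c d
  simp only [Matrix.add_apply, Matrix.smul_apply, smul_eq_mul, map_one, map_neg,
    Complex.conj_I] at h1 h2 h3 h4
  linear_combination (1 / 4 : ℂ) * (h1 + h2 - h3 - h4) + (1 / 2 : ℂ) *
    ((C a b - B a b) * (C c d - B c d) - (C a d - B a d) * (C c b - B c b)) * Complex.I_sq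

/-- A second circle, of radius `√2` via `z ↦ (1 + i) z`, decouples them: the first gives `m(B) +
m(C) = 0`, the second `-2i m(B) + 2i m(C) = 0`. -/
theorem MinorsVanish.of_hermitian_pencil {A B C D : Matrix κ κ ℂ}
    (h : ∀ z : ℂ, MinorsVanish (A + conj z • B + z • C + (z * conj z) • D)) : MinorsVanish C := by
  intro a b c d
  have h1 := minor_add_minor_eq_zero (A := A) (B := B) (C := C) (D := D)
    (fun z hz => by simpa [hz] using h z) a b c d
  have h2 := minor_add_minor_eq_zero (A := A) (B := (1 - Complex.I) • B) (C := (1 + Complex.I) • C)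
    (D := (2 : ℂ) • D) (fun z hz => by
      have := h ((1 + Complex.I) * z)
      have e1 : conj ((1 + Complex.I) * z) = conj z * (1 - Complex.I) := by
        simp only [map_mul, map_add, map_one, Complex.conj_I]; ring
      have e2 : (1 + Complex.I) * z * (conj z * (1 - Complex.I)) = 2 := by
        linear_combination (1 - Complex.I ^ 2) * hz - Complex.I_sq
      rw [e1, e2, mul_comm _ z] at this
      simpa only [smul_smul] using this) a b c d
  simp only [Matrix.smul_apply, smul_eq_mul] at h2
  have h3 : Complex.I * (4 * (C a b * C c d - C a d * C c b)) = 0 := by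
    linear_combination h2 + 2 * Complex.I * h1 - ((B a b * B c d - B a d * B c b) +
      (C a b * C c d - C a d * C c b)) * Complex.I_sq
  have h4 := (mul_eq_zero.1 h3).resolve_left Complex.I_ne_zero
  linear_combination (1 / 4 : ℂ) * h4

theorem eq_smul_of_wedge_eq_zero [Fintype κ] {u a : κ → ℂ} (hu : u ⬝ᵥ star u = 1)
    (h : ∀ p r, u p * a r = a p * u r) : a = (a ⬝ᵥ star u) • u := by
  funext r
  rw [Pi.smul_apply, smul_eq_mul, dotProduct, Finset.sum_mul]
  calc a r = (u ⬝ᵥ star u) * a r := by rw [hu, one_mul]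
    _ = _ := by
      rw [dotProduct, Finset.sum_mul]
      refine Finset.sum_congr rfl fun p _ => ?_
      linear_combination (star u p) * h p r

theorem dotProduct_star_star [Fintype κ] {u : κ → ℂ} (hu : u ⬝ᵥ star u = 1) :
    star u ⬝ᵥ star (star u) = 1 := by
  rw [star_star, dotProduct_comm, hu]

/-- The polarized minor factors as `(u ∧ a)` times `(ū ∧ b)`, so one wedge vanishes. -/
theorem MinorsOrthogonal.parallel [Fintype κ] {u a b : κ → ℂ} (hu : u ⬝ᵥ star u = 1)
    (h : MinorsOrthogonal (Matrix.vecMulVec u (star u)) (Matrix.vecMulVec a b)) :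
    (∃ α : ℂ, a = α • u) ∨ (∃ β : ℂ, b = β • star u) := by
  by_cases ha : ∀ p r, u p * a r = a p * u r
  · exact Or.inl ⟨_, eq_smul_of_wedge_eq_zero hu ha⟩
  · right
    push Not at ha
    obtain ⟨p, r, hpr⟩ := ha
    refine ⟨_, eq_smul_of_wedge_eq_zero (dotProduct_star_star hu) fun q s => ?_⟩
    have := h p q r s
    simp only [Matrix.vecMulVec_apply] at this
    apply mul_left_cancel₀ (sub_ne_zero.2 hpr)
    linear_combination this

theorem outer_eq_of_parallel [Fintype κ] {u v : κ → ℂ} (hu : u ⬝ᵥ star u = 1)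
    (hv : v ⬝ᵥ star v = 1) {c : ℂ} (h : u = c • v) :
    Matrix.vecMulVec u (star u) = Matrix.vecMulVec v (star v) := by
  have hc : c * star c = 1 := by
    rw [h, star_smul, smul_dotProduct, dotProduct_smul, hv] at hu
    simpa using hu
  rw [h, star_smul, Matrix.smul_vecMulVec, Matrix.vecMulVec_smul, smul_smul, hc, one_smul]

theorem not_parallel_both [Fintype κ] {u v a : κ → ℂ} (hu : u ⬝ᵥ star u = 1)
    (hv : v ⬝ᵥ star v = 1) (huv : Matrix.vecMulVec u (star u) ≠ Matrix.vecMulVec v (star v))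
    (ha : a ≠ 0) {α β : ℂ} (h1 : a = α • u) (h2 : a = β • v) : False := by
  have hα : α ≠ 0 := by
    rintro rfl
    exact ha (by simpa using h1)
  refine huv (outer_eq_of_parallel hu hv (c := α⁻¹ * β) ?_)
  rw [← smul_smul, ← h2, h1, smul_smul, inv_mul_cancel₀ hα, one_smul]

/-- Write `C = a bᵀ`. Each of `u`, `v` is parallel to the column `a` or, conjugated, to the row `b`.
Both cannot take the same side, so one takes each; trace zero then says `u ⊥ v`. -/
theorem eq_smul_outer_of_minors [Fintype κ] {u v : κ → ℂ} {C : Matrix κ κ ℂ}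
    (hu : u ⬝ᵥ star u = 1) (hv : v ⬝ᵥ star v = 1)
    (huv : Matrix.vecMulVec u (star u) ≠ Matrix.vecMulVec v (star v)) (hC : MinorsVanish C)
    (hCu : MinorsOrthogonal (Matrix.vecMulVec u (star u)) C)
    (hCv : MinorsOrthogonal (Matrix.vecMulVec v (star v)) C)
    (hC0 : C ≠ 0) (htr : C.trace = 0) :
    u ⬝ᵥ star v = 0 ∧ ∃ ω : ℂ, ω ≠ 0 ∧
      (C = ω • Matrix.vecMulVec u (star v) ∨ C = ω • Matrix.vecMulVec v (star u)) := by
  obtain ⟨a, b, rfl⟩ := hC.exists_eq_vecMulVec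
  have ha : a ≠ 0 := by rintro rfl; simp at hC0
  have hb : b ≠ 0 := by rintro rfl; simp at hC0
  have key : ∀ {x y : κ → ℂ} {α β : ℂ}, a = α • x → b = β • star y →
      α * β ≠ 0 ∧ Matrix.vecMulVec a b = (α * β) • Matrix.vecMulVec x (star y) ∧
        x ⬝ᵥ star y = 0 := by
    rintro x y α β rfl rfl
    have hαβ : α * β ≠ 0 := by
      intro h0
      rcases mul_eq_zero.1 h0 with h | h
      · exact ha (by simp [h])
      · exact hb (by simp [h])
    rw [Matrix.trace_vecMulVec, smul_dotProduct, dotProduct_smul, smul_smul, smul_eq_mul] at htr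
    exact ⟨hαβ, by rw [Matrix.smul_vecMulVec, Matrix.vecMulVec_smul, smul_smul],
      (mul_eq_zero.1 htr).resolve_left hαβ⟩
  rcases hCu.parallel hu with ⟨α, hα⟩ | ⟨α, hα⟩ <;> rcases hCv.parallel hv with ⟨β, hβ⟩ | ⟨β, hβ⟩
  · exact (not_parallel_both hu hv huv ha hα hβ).elim
  · obtain ⟨h0, h1, h2⟩ := key hα hβ
    exact ⟨h2, _, h0, Or.inl h1⟩
  · obtain ⟨h0, h1, h2⟩ := key hβ hα
    refine ⟨?_, _, h0, Or.inr h1⟩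
    have := congrArg star h2
    simpa [dotProduct, mul_comm] using this
  · refine (not_parallel_both (dotProduct_star_star hu) (dotProduct_star_star hv) ?_ hb hα hβ).elim
    intro h
    apply huv
    have := congrArg Matrix.transpose h
    rwa [Matrix.transpose_vecMulVec, Matrix.transpose_vecMulVec, star_star, star_star] at this

end Minors

/-! ### Complex-linear maps sending rank-one matrices to rank at most one -/

section RankOnePreserver

variable {ι κ : Type}

theorem minors_polarization {Φ : Matrix ι ι ℂ →ₗ[ℂ] Matrix κ κ ℂ}
    (h : ∀ x y, MinorsVanish (Φ (Matrix.vecMulVec x y))) (x x' y : ι → ℂ) :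
    MinorsOrthogonal (Φ (Matrix.vecMulVec x y)) (Φ (Matrix.vecMulVec x' y)) := by
  intro a b c d
  have h1 := h (x + x') y a b c d
  have h2 := h x y a b c d
  have h3 := h x' y a b c d
  simp only [Matrix.add_vecMulVec, map_add, Matrix.add_apply] at h1
  linear_combination h1 - h2 - h3

theorem minors_polarization_right {Φ : Matrix ι ι ℂ →ₗ[ℂ] Matrix κ κ ℂ}
    (h : ∀ x y, MinorsVanish (Φ (Matrix.vecMulVec x y))) (x y y' : ι → ℂ) :
    MinorsOrthogonal (Φ (Matrix.vecMulVec x y)) (Φ (Matrix.vecMulVec x y')) := by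
  intro a b c d
  have h1 := h x (y + y') a b c d
  have h2 := h x y a b c d
  have h3 := h x y' a b c d
  simp only [Matrix.vecMulVec_add, map_add, Matrix.add_apply] at h1
  linear_combination h1 - h2 - h3

/-- Full polarization couples the pair `(x y, x' y')` with the pair `(x y', x' y)`; the hypothesis
`h0` removes the latter. -/
theorem minors_polarization_four {Φ : Matrix ι ι ℂ →ₗ[ℂ] Matrix κ κ ℂ}
    (h : ∀ x y, MinorsVanish (Φ (Matrix.vecMulVec x y))) (x x' y y' : ι → ℂ)
    (h0 : Φ (Matrix.vecMulVec x y') = 0) :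
    MinorsOrthogonal (Φ (Matrix.vecMulVec x y)) (Φ (Matrix.vecMulVec x' y')) := by
  intro a b c d
  have h1 := h (x + x') (y + y') a b c d
  have h2 := minors_polarization h x x' y a b c d
  have h3 := minors_polarization_right h x' y y' a b c d
  have h4 := h x y a b c d
  have h5 := h x' y a b c d
  have h6 := h x' y' a b c d
  simp only [Matrix.vecMulVec_add, Matrix.add_vecMulVec, map_add, Matrix.add_apply, h0,
    Matrix.zero_apply] at h1
  linear_combination h1 - h2 - h3 - h4 - h5 - h6

theorem MinorsVanish.compress [Fintype κ] {M : Matrix κ κ ℂ} (h : MinorsVanish M) (u : ι → κ → ℂ)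
    (p q r s : ι) : (star (u p) ⬝ᵥ (M *ᵥ u q)) * (star (u r) ⬝ᵥ (M *ᵥ u s)) =
      (star (u p) ⬝ᵥ (M *ᵥ u s)) * (star (u r) ⬝ᵥ (M *ᵥ u q)) := by
  obtain ⟨a, b, rfl⟩ := h.exists_eq_vecMulVec
  simp only [Matrix.vecMulVec_mulVec, dotProduct_smul, MulOpposite.smul_eq_mul_unop,
    MulOpposite.unop_op]
  ring

theorem star_dotProduct_smul_vecMulVec_mulVec [Fintype κ] (z : ℂ) (x y v w : κ → ℂ) :
    star v ⬝ᵥ ((z • Matrix.vecMulVec x (star y)) *ᵥ w) = z * (star v ⬝ᵥ x) * (star y ⬝ᵥ w) := by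
  simp only [Matrix.smul_mulVec, Matrix.vecMulVec_mulVec, dotProduct_smul,
    MulOpposite.smul_eq_mul_unop, MulOpposite.unop_op, smul_eq_mul]
  ring

variable [Fintype ι] [DecidableEq ι]

theorem map_eq_sum_single (Φ : Matrix ι ι ℂ →ₗ[ℂ] Matrix κ κ ℂ) (X : Matrix ι ι ℂ) :
    Φ X = ∑ j, ∑ l, X j l • Φ (Matrix.single j l 1) := by
  conv_lhs => rw [Matrix.matrix_eq_sum_single X]
  simp only [map_sum]
  refine Finset.sum_congr rfl fun j _ => Finset.sum_congr rfl fun l _ => ?_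
  rw [← map_smul, Matrix.smul_single, smul_eq_mul, mul_one]

variable [Fintype κ]

/-- If matrix units `e_j e_l^T` are mapped to multiples of `u_j u_l*` with `u` orthonormal, and
matrices of rank one to matrices of rank at most one, then the map is `X ↦ U X U*`. -/
theorem exists_isometry_of_forall_single [Nonempty ι] {Φ : Matrix ι ι ℂ →ₗ[ℂ] Matrix κ κ ℂ}
    (hΦ : ∀ x y, MinorsVanish (Φ (Matrix.vecMulVec x y))) {u : ι → κ → ℂ}
    (hu : ∀ j l, star (u j) ⬝ᵥ u l = if j = l then 1 else 0)
    (hdiag : ∀ j, Φ (Matrix.single j j 1) = Matrix.vecMulVec (u j) (star (u j)))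
    (hstar : ∀ j l, Φ (Matrix.single l j 1) = (Φ (Matrix.single j l 1))ᴴ)
    (hform : ∀ j l, ∃ ω : ℂ, Φ (Matrix.single j l 1) = ω • Matrix.vecMulVec (u j) (star (u l))) :
    ∃ U : Matrix κ ι ℂ, Uᴴ * U = 1 ∧ ∀ X, Φ X = U * X * Uᴴ := by
  choose ω hω using hform
  have hcomp : ∀ X p q, star (u p) ⬝ᵥ (Φ X *ᵥ u q) = X p q * ω p q := by
    intro X p q
    rw [map_eq_sum_single, Matrix.sum_mulVec, dotProduct_sum]
    simp only [Matrix.sum_mulVec, dotProduct_sum, hω, smul_smul,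
      star_dotProduct_smul_vecMulVec_mulVec, hu]
    simp
  -- The all-ones matrix has rank one, and its image has coefficients `ω p q`, so `ω` itself has
  -- vanishing minors.
  have hminor : ∀ p q r s, ω p q * ω r s = ω p s * ω r q := by
    intro p q r s
    have := (hΦ 1 1).compress u p q r s
    simpa only [hcomp, Matrix.vecMulVec_apply, Pi.one_apply, one_mul] using this
  have hω1 : ∀ j, ω j j = 1 := by
    intro j
    have h1 := hcomp (Matrix.single j j 1) j j
    rw [hdiag, ← one_smul ℂ (Matrix.vecMulVec _ _), star_dotProduct_smul_vecMulVec_mulVec, hu] at h1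
    simpa using h1.symm
  have hωs : ∀ j l, ω l j = star (ω j l) := by
    intro j l
    have h1 := hcomp (Matrix.single l j 1) l j
    rw [hstar, hω, Matrix.conjTranspose_smul, Matrix.conjTranspose_vecMulVec, star_star,
      star_dotProduct_smul_vecMulVec_mulVec, hu, hu] at h1
    simpa using h1.symm
  obtain ⟨o⟩ := ‹Nonempty ι›
  -- A Hermitian `ω` with vanishing minors and unit diagonal is `ω j l = ω j o * star (ω l o)`;
  -- these phases are absorbed into the columns `u j`.
  refine ⟨Matrix.of fun a j => ω j o * u j a, ?_, fun X => ?_⟩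
  · ext j l
    have h1 : ((Matrix.of fun a j => ω j o * u j a)ᴴ * (Matrix.of fun a j => ω j o * u j a)) j l =
        star (ω j o) * ω l o * (star (u j) ⬝ᵥ u l) := by
      rw [Matrix.mul_apply, dotProduct, Finset.mul_sum]
      refine Finset.sum_congr rfl fun a _ => ?_
      simp only [Matrix.conjTranspose_apply, Matrix.of_apply, star_mul', Pi.star_apply]
      ring
    rw [h1, hu, Matrix.one_apply]
    split_ifs with hjl
    · subst hjl
      rw [← hωs, hminor, hω1, hω1]
      simp
    · simp
  · ext a b
    rw [map_eq_sum_single, Matrix.mul_assoc, Matrix.mul_apply, Matrix.sum_apply]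
    refine Finset.sum_congr rfl fun j _ => ?_
    rw [Matrix.mul_apply, Matrix.sum_apply, Finset.mul_sum]
    refine Finset.sum_congr rfl fun l _ => ?_
    have h1 : ω j l = ω j o * star (ω l o) := by
      rw [← hωs, hminor, hω1, mul_one]
    rw [hω, h1]
    simp only [Matrix.smul_apply, Matrix.vecMulVec_apply, Matrix.of_apply,
      Matrix.conjTranspose_apply, star_mul', Pi.star_apply, smul_eq_mul]
    ring

/-- A row `p` with one flipped and one unflipped off-diagonal unit would send `e_p (e_q + e_r)ᵀ` to
`ω u_q u_p* + ω' u_p u_r*`, of rank two. So one flip fills its row off the diagonal, and taking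
adjoints spreads it to all rows. -/
theorem forall_or_forall_of_minors {Φ : Matrix ι ι ℂ →ₗ[ℂ] Matrix κ κ ℂ}
    (hΦ : ∀ x y, MinorsVanish (Φ (Matrix.vecMulVec x y))) {u : ι → κ → ℂ}
    (hu : ∀ j l, star (u j) ⬝ᵥ u l = if j = l then 1 else 0)
    (hdiag : ∀ j, Φ (Matrix.single j j 1) = Matrix.vecMulVec (u j) (star (u j)))
    (hstar : ∀ j l, Φ (Matrix.single l j 1) = (Φ (Matrix.single j l 1))ᴴ)
    (hform : ∀ j l, j ≠ l → ∃ ω : ℂ, ω ≠ 0 ∧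
      (Φ (Matrix.single j l 1) = ω • Matrix.vecMulVec (u j) (star (u l)) ∨
        Φ (Matrix.single j l 1) = ω • Matrix.vecMulVec (u l) (star (u j)))) :
    (∀ j l, ∃ ω : ℂ, Φ (Matrix.single j l 1) = ω • Matrix.vecMulVec (u j) (star (u l))) ∨
    (∀ j l, ∃ ω : ℂ, Φ (Matrix.single j l 1) = ω • Matrix.vecMulVec (u l) (star (u j))) := by
  set T : ι → ι → Prop := fun j l =>
    ∃ ω : ℂ, Φ (Matrix.single j l 1) = ω • Matrix.vecMulVec (u j) (star (u l)) with hT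
  by_cases hall : ∀ j l, T j l
  · exact Or.inl hall
  right
  push Not at hall
  obtain ⟨j, l, hjl⟩ := hall
  have hTdiag : ∀ p, T p p := fun p => ⟨1, by rw [hdiag, one_smul]⟩
  have hne : ∀ {p q}, ¬ T p q → p ≠ q := by
    rintro p q h rfl
    exact h (hTdiag p)
  have hother : ∀ {p q}, ¬ T p q → ∃ ω : ℂ, ω ≠ 0 ∧
      Φ (Matrix.single p q 1) = ω • Matrix.vecMulVec (u q) (star (u p)) := by
    intro p q h
    obtain ⟨ω, h0, h1 | h1⟩ := hform p q (hne h)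
    · exact (h ⟨ω, h1⟩).elim
    · exact ⟨ω, h0, h1⟩
  have hsymm : ∀ {p q}, ¬ T p q → ¬ T q p := by
    rintro p q h ⟨ω, hω⟩
    refine h ⟨star ω, ?_⟩
    rw [hstar q p, hω, Matrix.conjTranspose_smul, Matrix.conjTranspose_vecMulVec, star_star]
  have hrow : ∀ {p q r}, ¬ T p q → r ≠ p → ¬ T p r := by
    intro p q r h hr
    by_cases hrq : r = q
    · rwa [hrq]
    intro hpr
    obtain ⟨ω', h0', h1'⟩ : ∃ ω : ℂ, ω ≠ 0 ∧
        Φ (Matrix.single p r 1) = ω • Matrix.vecMulVec (u p) (star (u r)) := by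
      obtain ⟨ω', h'⟩ := hpr
      obtain ⟨η, h0, h1⟩ := hform p r (Ne.symm hr)
      refine ⟨ω', ?_, h'⟩
      rintro rfl
      rw [zero_smul] at h'
      have hnz : ∀ a b, star (u a) ⬝ᵥ (Matrix.vecMulVec (u a) (star (u b)) *ᵥ u b) = 1 := by
        intro a b
        rw [← one_smul ℂ (Matrix.vecMulVec _ _), star_dotProduct_smul_vecMulVec_mulVec, hu, hu]
        simp
      rw [h'] at h1
      rcases h1 with h1 | h1
      · have := hnz p r
        rw [(smul_eq_zero.1 h1.symm).resolve_left h0] at this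
        simp at this
      · have := hnz r p
        rw [(smul_eq_zero.1 h1.symm).resolve_left h0] at this
        simp at this
    obtain ⟨ω, h0, h1⟩ := hother h
    have hM : Φ (Matrix.vecMulVec (Pi.single p 1) (Pi.single q 1 + Pi.single r 1)) =
        ω • Matrix.vecMulVec (u q) (star (u p)) + ω' • Matrix.vecMulVec (u p) (star (u r)) := by
      rw [← h1, ← h1', ← map_add, Matrix.vecMulVec_add,
        ← Matrix.single_eq_single_vecMulVec_single, ← Matrix.single_eq_single_vecMulVec_single]
    have hmin := (hΦ (Pi.single p 1) (Pi.single q 1 + Pi.single r 1)).compress u q p p r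
    rw [hM] at hmin
    simp only [Matrix.add_mulVec, dotProduct_add, star_dotProduct_smul_vecMulVec_mulVec, hu] at hmin
    have hpq := hne h
    simp [hr, Ne.symm hr, hpq, Ne.symm hpq, h0, h0'] at hmin
  intro p q
  by_cases hpq : p = q
  · subst hpq
    exact hTdiag p
  -- The flip travels from `(j, l)` along row `j` to `(j, p)`, by adjoint to `(p, j)`, and along row
  -- `p` to `(p, q)`.
  have hTpq : ¬ T p q := by
    by_cases hpj : p = j
    · subst hpj
      exact hrow hjl (Ne.symm hpq)
    · exact hrow (hsymm (hrow hjl hpj)) (Ne.symm hpq)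
  obtain ⟨ω, -, h⟩ := hother hTpq
  exact ⟨ω, h⟩

end RankOnePreserver

/-! ### Complexification and the Wigner-type theorem -/

section Complexification

variable {ι κ : Type} [Fintype ι] [DecidableEq ι] [Fintype κ] [DecidableEq κ]

/-- The complex-linear extension of a real-linear map between spaces of Hermitian matrices. -/
noncomputable def complexify (ψ : Herm ι →ₗ[ℝ] Herm κ) :
    Matrix ι ι ℂ →ₗ[ℂ] Matrix κ κ ℂ where
  toFun X := (ψ (realPart X) : Matrix κ κ ℂ) + Complex.I • (ψ (imaginaryPart X) : Matrix κ κ ℂ)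
  map_add' X Y := by
    simp only [map_add, AddSubgroup.coe_add, smul_add]
    abel
  map_smul' z X := by
    ext a b
    simp only [realPart_smul, imaginaryPart_smul, map_add, map_sub, map_smul, AddSubgroup.coe_add,
      AddSubgroup.coe_sub, selfAdjoint.val_smul, Matrix.add_apply, Matrix.sub_apply,
      Matrix.smul_apply, smul_eq_mul, Complex.real_smul, RingHom.id_apply]
    conv_rhs => rw [← Complex.re_add_im z]
    linear_combination (-(z.im : ℂ) * (ψ (imaginaryPart X) : Matrix κ κ ℂ) a b) * Complex.I_sq

theorem complexify_apply (ψ : Herm ι →ₗ[ℝ] Herm κ) (X : Matrix ι ι ℂ) : complexify ψ X =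
    (ψ (realPart X) : Matrix κ κ ℂ) + Complex.I • (ψ (imaginaryPart X) : Matrix κ κ ℂ) := rfl

theorem complexify_coe (ψ : Herm ι →ₗ[ℝ] Herm κ) (A : Herm ι) :
    complexify ψ (A : Matrix ι ι ℂ) = ψ A := by
  rw [complexify_apply, selfAdjoint.realPart_coe, selfAdjoint.imaginaryPart_coe]
  simp

theorem complexify_conjTranspose (ψ : Herm ι →ₗ[ℝ] Herm κ) (X : Matrix ι ι ℂ) :
    complexify ψ Xᴴ = (complexify ψ X)ᴴ := by
  have h1 : realPart Xᴴ = realPart X := by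
    apply Subtype.ext
    rw [realPart_apply_coe, realPart_apply_coe, ← Matrix.star_eq_conjTranspose, star_star, add_comm]
  have h2 : imaginaryPart Xᴴ = -imaginaryPart X := by
    apply Subtype.ext
    rw [AddSubgroup.coe_neg, imaginaryPart_apply_coe, imaginaryPart_apply_coe,
      ← Matrix.star_eq_conjTranspose, star_star, ← neg_sub, smul_neg, smul_neg]
  rw [complexify_apply, complexify_apply, h1, h2, Matrix.conjTranspose_add,
    Matrix.conjTranspose_smul, (isHermitian_coe _).eq, (isHermitian_coe _).eq]
  simp

theorem trace_map_of_pureStates {ψ : Herm ι →ₗ[ℝ] Herm κ}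
    (hψ : ∀ P ∈ pureStates ι, ψ P ∈ pureStates κ) (A : Herm ι) :
    (ψ A : Matrix κ κ ℂ).trace = (A : Matrix ι ι ℂ).trace := by
  have hA : A ∈ Submodule.span ℝ (pureStates ι) := by rw [span_pureStates]; trivial
  induction hA using Submodule.span_induction with
  | mem P hP => rw [(hψ P hP).2, hP.2]
  | zero => simp
  | add x y _ _ hx hy => simp [hx, hy]
  | smul c x _ hx => simp [hx]

theorem trace_complexify {ψ : Herm ι →ₗ[ℝ] Herm κ}
    (hψ : ∀ P ∈ pureStates ι, ψ P ∈ pureStates κ) (X : Matrix ι ι ℂ) :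
    (complexify ψ X).trace = X.trace := by
  conv_rhs => rw [← realPart_add_I_smul_imaginaryPart X]
  rw [complexify_apply, Matrix.trace_add, Matrix.trace_add, Matrix.trace_smul, Matrix.trace_smul,
    trace_map_of_pureStates hψ, trace_map_of_pureStates hψ]

theorem minorsVanish_map_outerHerm {ψ : Herm ι →ₗ[ℝ] Herm κ}
    (hψ : ∀ P ∈ pureStates ι, ψ P ∈ pureStates κ) (x : ι → ℂ) :
    MinorsVanish (ψ (outerHerm x) : Matrix κ κ ℂ) := by
  set t : ℝ := ∑ i, ‖x i‖ ^ 2 with ht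
  have hxt : x ⬝ᵥ star x = (t : ℂ) := by
    rw [dotProduct, ht, Complex.ofReal_sum]
    refine Finset.sum_congr rfl fun i _ => ?_
    rw [Pi.star_apply, Complex.star_def, Complex.mul_conj', Complex.ofReal_pow]
  have ht0 : 0 ≤ t := Finset.sum_nonneg fun i _ => by positivity
  by_cases h0 : t = 0
  · have hx : x = 0 := by
      funext i
      have := (Finset.sum_eq_zero_iff_of_nonneg (fun i _ => by positivity)).1 h0 i
        (Finset.mem_univ i)
      simpa using this
    have : outerHerm x = 0 := by
      apply Subtype.ext
      rw [coe_outerHerm, hx]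
      simp
    rw [this, map_zero]
    intro a b c d
    simp
  · obtain ⟨s, hs⟩ : ∃ s : ℂ, s * star s = (t : ℂ)⁻¹ := by
      refine ⟨((√(t⁻¹) : ℝ) : ℂ), ?_⟩
      rw [Complex.star_def, Complex.conj_ofReal, ← Complex.ofReal_mul,
        Real.mul_self_sqrt (by positivity), Complex.ofReal_inv]
    have ht0' : (t : ℂ) ≠ 0 := by exact_mod_cast h0
    have hunit : (s • x) ⬝ᵥ star (s • x) = 1 := by
      rw [star_smul, smul_dotProduct, dotProduct_smul, hxt, smul_eq_mul, smul_eq_mul, ← mul_assoc,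
        hs, inv_mul_cancel₀ ht0']
    have hsc : outerHerm x = t • outerHerm (s • x) := by
      apply Subtype.ext
      rw [selfAdjoint.val_smul, coe_outerHerm, coe_outerHerm, star_smul, Matrix.smul_vecMulVec,
        Matrix.vecMulVec_smul, smul_smul, hs, ← Complex.coe_smul, smul_smul,
        mul_inv_cancel₀ ht0', one_smul]
    obtain ⟨v, -, hv⟩ := mem_pureStates_iff.1 (hψ _ (outerHerm_mem_pureStates hunit))
    rw [hsc, map_smul, hv, selfAdjoint.val_smul, ← Complex.coe_smul, coe_outerHerm]
    exact (minorsVanish_vecMulVec _ _).smul _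

/-- The matrix `x yᵀ` is the coefficient of `z` in the Hermitian pencil `(ȳ + z x)(ȳ + z x)*`, whose
image has vanishing minors for every `z`. -/
theorem minorsVanish_complexify {ψ : Herm ι →ₗ[ℝ] Herm κ}
    (hψ : ∀ P ∈ pureStates ι, ψ P ∈ pureStates κ) (x y : ι → ℂ) :
    MinorsVanish (complexify ψ (Matrix.vecMulVec x y)) := by
  refine MinorsVanish.of_hermitian_pencil
    (A := complexify ψ (Matrix.vecMulVec (star y) y))
    (B := complexify ψ (Matrix.vecMulVec (star y) (star x)))
    (D := complexify ψ (Matrix.vecMulVec x (star x))) fun z => ?_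
  have h := minorsVanish_map_outerHerm hψ (star y + z • x)
  rw [← complexify_coe] at h
  convert h using 1
  simp only [← map_smul, ← map_add]
  congr 1
  ext a b
  simp only [outerHerm_apply, Matrix.add_apply, Matrix.smul_apply, Matrix.vecMulVec_apply,
    Pi.add_apply, Pi.smul_apply, Pi.star_apply, smul_eq_mul, star_add, star_mul',
    Complex.star_def, Complex.conj_conj]
  ring

/-- A linear map that injects the pure states into pure states is `X ↦ U X U*` or `X ↦ U X^T U*`
for an isometry `U`. -/
theorem exists_isometry_of_pureStates [Nonempty ι] (ψ : Herm ι →ₗ[ℝ] Herm κ)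
    (hψ : ∀ P ∈ pureStates ι, ψ P ∈ pureStates κ) (hinj : Set.InjOn ψ (pureStates ι)) :
    ∃ U : Matrix κ ι ℂ, Uᴴ * U = 1 ∧
      ((∀ X, (ψ X : Matrix κ κ ℂ) = U * (X : Matrix ι ι ℂ) * Uᴴ) ∨
        (∀ X, (ψ X : Matrix κ κ ℂ) = U * (X : Matrix ι ι ℂ)ᵀ * Uᴴ)) := by
  have hminor := minorsVanish_complexify hψ
  have hstar : ∀ j l, complexify ψ (Matrix.single l j 1) =
      (complexify ψ (Matrix.single j l 1))ᴴ := fun j l => by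
    rw [← complexify_conjTranspose, Matrix.conjTranspose_single, star_one]
  have hE : ∀ j : ι, outerHerm (Pi.single j (1 : ℂ)) ∈ pureStates ι := fun j =>
    outerHerm_mem_pureStates (by simp)
  have hEc : ∀ j : ι, (outerHerm (Pi.single j (1 : ℂ)) : Matrix ι ι ℂ) = Matrix.single j j 1 := by
    intro j
    rw [coe_outerHerm, ← Pi.single_star, star_one, ← Matrix.single_eq_single_vecMulVec_single]
  choose u hu hψu using fun j => mem_pureStates_iff.1 (hψ _ (hE j))
  have hdiag : ∀ j, complexify ψ (Matrix.single j j 1) = Matrix.vecMulVec (u j) (star (u j)) := by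
    intro j
    rw [← hEc, complexify_coe, hψu, coe_outerHerm]
  have hne : ∀ j l, j ≠ l →
      Matrix.vecMulVec (u j) (star (u j)) ≠ Matrix.vecMulVec (u l) (star (u l)) := by
    intro j l hjl h
    have h1 : ψ (outerHerm (Pi.single j 1)) = ψ (outerHerm (Pi.single l 1)) := by
      rw [hψu, hψu]
      exact Subtype.ext h
    have h2 := congrArg (fun A : Herm ι => (A : Matrix ι ι ℂ) j j) (hinj (hE j) (hE l) h1)
    simp [hEc, Ne.symm hjl] at h2
  -- Were the image zero, polarization would make `u j` and `u l` parallel, contrary to injectivity.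
  have hnz : ∀ j l, j ≠ l → complexify ψ (Matrix.single j l 1) ≠ 0 := by
    intro j l hjl h0
    have h := minors_polarization_four hminor (Pi.single j 1) (Pi.single l 1) (Pi.single j 1)
      (Pi.single l 1) (by rw [← Matrix.single_eq_single_vecMulVec_single, h0])
    rw [← Matrix.single_eq_single_vecMulVec_single, ← Matrix.single_eq_single_vecMulVec_single,
      hdiag, hdiag] at h
    rcases h.parallel (hu j) with ⟨α, hα⟩ | ⟨α, hα⟩
    · exact hne j l hjl (outer_eq_of_parallel (hu l) (hu j) hα).symm
    · refine hne j l hjl (outer_eq_of_parallel (hu l) (hu j) (c := star α) ?_).symm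
      rw [← star_star (u l), hα, star_smul, star_star]
  have hpair := fun j l (hjl : j ≠ l) => eq_smul_outer_of_minors (hu j) (hu l) (hne j l hjl)
    (C := complexify ψ (Matrix.single j l 1))
    (by rw [Matrix.single_eq_single_vecMulVec_single]; exact hminor _ _)
    (by
      rw [← hdiag, Matrix.single_eq_single_vecMulVec_single,
        Matrix.single_eq_single_vecMulVec_single]
      exact minors_polarization_right hminor _ _ _)
    (by
      rw [← hdiag, Matrix.single_eq_single_vecMulVec_single,
        Matrix.single_eq_single_vecMulVec_single]
      exact minors_polarization hminor _ _ _)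
    (hnz j l hjl) (by rw [trace_complexify hψ, Matrix.trace_single_eq_of_ne _ _ _ hjl])
  have hon : ∀ j l, star (u j) ⬝ᵥ u l = if j = l then 1 else 0 := by
    intro j l
    rw [dotProduct_comm]
    split_ifs with h
    · rw [h, hu]
    · exact (hpair l j (Ne.symm h)).1
  rcases forall_or_forall_of_minors hminor hon hdiag hstar (fun j l h => (hpair j l h).2) with h | h
  · obtain ⟨U, hU, hX⟩ := exists_isometry_of_forall_single hminor hon hdiag hstar h
    exact ⟨U, hU, Or.inl fun X => by rw [← complexify_coe, hX]⟩
  · obtain ⟨U, hU, hX⟩ := exists_isometry_of_forall_single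
      (Φ := complexify ψ ∘ₗ (Matrix.transposeLinearEquiv ι ι ℂ ℂ).toLinearMap) (u := u)
      (fun x y => by simpa [Matrix.transpose_vecMulVec] using hminor y x) hon
      (fun j => by simpa using hdiag j) (fun j l => by simpa using hstar l j)
      (fun j l => by simpa using h l j)
    refine ⟨U, hU, Or.inr fun X => ?_⟩
    rw [← complexify_coe, ← hX]
    simp

end Complexification

/-! ### Extreme points of the set of separable states -/

section Extreme

/-- The entries of a Hermitian matrix as a vector of a Euclidean space. -/
def hermToEuclidean (ι : Type) [Fintype ι] [DecidableEq ι] :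
    Herm ι →ₗ[ℝ] EuclideanSpace ℂ (ι × ι) where
  toFun A := WithLp.toLp 2 fun p => (A : Matrix ι ι ℂ) p.1 p.2
  map_add' _ _ := rfl
  map_smul' _ _ := rfl

theorem hermToEuclidean_injective {ι : Type} [Fintype ι] [DecidableEq ι] :
    Function.Injective (hermToEuclidean ι) := by
  intro A B h
  apply Subtype.ext
  ext a b
  exact congrFun (congrArg WithLp.ofLp h) (a, b)

instance finiteDimensional_herm {ι : Type} [Fintype ι] [DecidableEq ι] :
    FiniteDimensional ℝ (Herm ι) :=
  FiniteDimensional.of_injective (hermToEuclidean ι) hermToEuclidean_injective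

theorem norm_sq_hermToEuclidean {ι : Type} [Fintype ι] [DecidableEq ι] (A : Herm ι) :
    ((‖hermToEuclidean ι A‖ ^ 2 : ℝ) : ℂ) = ((A : Matrix ι ι ℂ) * (A : Matrix ι ι ℂ)).trace := by
  rw [EuclideanSpace.norm_sq_eq, Fintype.sum_prod_type, Complex.ofReal_sum, Matrix.trace]
  refine Finset.sum_congr rfl fun a _ => ?_
  rw [Complex.ofReal_sum, Matrix.diag_apply, Matrix.mul_apply]
  refine Finset.sum_congr rfl fun b _ => ?_
  rw [← (isHermitian_coe A).apply b a, Complex.star_def, Complex.mul_conj', Complex.ofReal_pow]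
  rfl

variable {k : ℕ} {n : Fin k → ℕ}

theorem norm_hermToEuclidean_of_mem {T : Herm (ProdIdx n)} (hT : T ∈ productPureStates n) :
    ‖hermToEuclidean _ T‖ = 1 := by
  obtain ⟨P, hP, rfl⟩ := hT
  have h := norm_sq_hermToEuclidean (tensorHerm P)
  rw [coe_tensorHerm, trace_tensorMatrix_mul,
    Finset.prod_eq_one fun i _ => trace_mul_self_of_mem_pureStates (hP i)] at h
  have h1 : ‖hermToEuclidean _ (tensorHerm P)‖ ^ 2 = 1 := by exact_mod_cast h
  exact (pow_eq_one_iff_of_nonneg (norm_nonneg _) two_ne_zero).1 h1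

/-- Product pure states lie on the unit sphere and their hull in the unit ball, where every sphere
point is extreme; extremality pulls back along the injective `L`. -/
theorem extremePoints_separableStates :
    (separableStates n).extremePoints ℝ = productPureStates n := by
  refine Set.Subset.antisymm extremePoints_convexHull_subset fun T hT => ?_
  set L := hermToEuclidean (ProdIdx n)
  have hball : ∀ X ∈ separableStates n, L X ∈ Metric.closedBall 0 1 := by
    have : separableStates n ⊆ L ⁻¹' Metric.closedBall 0 1 :=
      convexHull_min (fun X hX => by simpa using (norm_hermToEuclidean_of_mem hX).le)
        ((convex_closedBall 0 1).linear_preimage L)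
    exact this
  have hLT : L T ∈ (Metric.closedBall 0 1 : Set (EuclideanSpace ℂ _)).extremePoints ℝ := by
    refine StrictConvexSpace.sphere_subset_extremePoints_closedBall 0 one_ne_zero ?_
    simpa using norm_hermToEuclidean_of_mem hT
  refine ⟨subset_convexHull ℝ _ hT, fun X hX Y hY hXY => ?_⟩
  refine hermToEuclidean_injective (hLT.2 (hball X hX) (hball Y hY) ?_)
  obtain ⟨a, b, ha, hb, hab, rfl⟩ := hXY
  exact ⟨a, b, ha, hb, hab, by rw [map_add, map_smul, map_smul]⟩

theorem injective_of_span_image {E : Type} [AddCommGroup E] [Module ℝ E] [FiniteDimensional ℝ E]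
    {S : Set E} (hS : Submodule.span ℝ S = ⊤) {f : E →ₗ[ℝ] E} (hf : S ⊆ f '' Submodule.span ℝ S) :
    Function.Injective f := by
  rw [LinearMap.injective_iff_surjective, ← LinearMap.range_eq_top, eq_top_iff, ← hS,
    Submodule.span_le]
  intro x hx
  obtain ⟨y, -, hy⟩ := hf hx
  exact ⟨y, hy⟩

theorem image_productPureStates_of_image_separableStates
    {Ψ : Herm (ProdIdx n) →ₗ[ℝ] Herm (ProdIdx n)}
    (h : Ψ '' separableStates n = separableStates n) :
    Ψ '' productPureStates n = productPureStates n := by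
  have hinj : Function.Injective Ψ := by
    refine injective_of_span_image span_productPureStates fun x hx => ?_
    have hx' : x ∈ Ψ '' separableStates n := by
      rw [h]; exact subset_convexHull ℝ _ hx
    obtain ⟨y, -, hy⟩ := hx'
    exact ⟨y, by rw [span_productPureStates]; trivial, hy⟩
  let e : Herm (ProdIdx n) ≃ₗ[ℝ] Herm (ProdIdx n) := LinearEquiv.ofInjectiveEndo Ψ hinj
  have he : ⇑e = Ψ := rfl
  rw [← extremePoints_separableStates, ← he, image_extremePoints, he, h]

end Extreme

section Main

variable {k : ℕ} {n : Fin k → ℕ}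

/-! ### Unitary conjugations and transpositions preserve pure states -/

theorem IsUnitaryConjOrTranspose.image_pureStates {m : ℕ} {ψ : Herm (Fin m) →ₗ[ℝ] Herm (Fin m)}
    (hψ : IsUnitaryConjOrTranspose ψ) : ψ '' pureStates (Fin m) = pureStates (Fin m) := by
  obtain ⟨U, hU, hform⟩ := hψ
  have hU1 : Uᴴ * U = 1 := Matrix.mem_unitaryGroup_iff'.1 hU
  have hU2 : U * Uᴴ = 1 := Matrix.mem_unitaryGroup_iff.1 hU
  have hconj : ∀ x : Fin m → ℂ, U * Matrix.vecMulVec x (star x) * Uᴴ = outerHerm (U *ᵥ x) := by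
    intro x
    rw [Matrix.mul_vecMulVec, Matrix.vecMulVec_mul, coe_outerHerm, Matrix.star_mulVec]
  have hnorm : ∀ V : Matrix (Fin m) (Fin m) ℂ, Vᴴ * V = 1 → ∀ x : Fin m → ℂ, x ⬝ᵥ star x = 1 →
      (V *ᵥ x) ⬝ᵥ star (V *ᵥ x) = 1 := by
    intro V hV x hx
    rw [dotProduct_comm, Matrix.star_mulVec, ← Matrix.dotProduct_mulVec, Matrix.mulVec_mulVec, hV,
      Matrix.one_mulVec, dotProduct_comm, hx]
  -- Transposing `x x*` conjugates `x`, so both forms are treated together with `θ` the identity or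
  -- conjugation.
  obtain ⟨θ, hθ, hθθ, hψθ⟩ : ∃ θ : (Fin m → ℂ) → (Fin m → ℂ),
      (∀ x, x ⬝ᵥ star x = 1 → θ x ⬝ᵥ star (θ x) = 1) ∧ (∀ x, θ (θ x) = x) ∧
      ∀ x, ψ (outerHerm x) = outerHerm (U *ᵥ θ x) := by
    rcases hform with h | h
    · exact ⟨id, fun x hx => hx, fun x => rfl, fun x => Subtype.ext (by
        rw [h, coe_outerHerm x, hconj]; rfl)⟩
    · refine ⟨star, fun x hx => dotProduct_star_star hx, star_star, fun x => Subtype.ext ?_⟩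
      rw [h, coe_outerHerm x, Matrix.transpose_vecMulVec, ← hconj, star_star]
  ext Q
  constructor
  · rintro ⟨P, hP, rfl⟩
    obtain ⟨x, hx, rfl⟩ := mem_pureStates_iff.1 hP
    rw [hψθ]
    exact outerHerm_mem_pureStates (hnorm U hU1 _ (hθ x hx))
  · intro hQ
    obtain ⟨y, hy, rfl⟩ := mem_pureStates_iff.1 hQ
    refine ⟨outerHerm (θ (Uᴴ *ᵥ y)), outerHerm_mem_pureStates (hθ _ (hnorm _ ?_ y hy)), ?_⟩
    · rwa [Matrix.conjTranspose_conjTranspose]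
    · rw [hψθ, hθθ, Matrix.mulVec_mulVec, hU2, Matrix.one_mulVec]

theorem castHerm_mem_pureStates {m m' : ℕ} (h : m = m') {A : Herm (Fin m)}
    (hA : A ∈ pureStates (Fin m)) : castHerm h A ∈ pureStates (Fin m') := by
  subst h
  exact hA

theorem castHerm_castHerm_symm {m m' : ℕ} (h : m = m') (A : Herm (Fin m')) :
    castHerm h (castHerm h.symm A) = A := by
  subst h
  rfl

theorem image_productPureStates_of_form {Ψ : Herm (ProdIdx n) →ₗ[ℝ] Herm (ProdIdx n)}
    {π : Equiv.Perm (Fin k)} {h : ∀ i, n (π i) = n i}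
    {ψ : (i : Fin k) → Herm (Fin (n i)) →ₗ[ℝ] Herm (Fin (n i))}
    (hψ : ∀ i, IsUnitaryConjOrTranspose (ψ i))
    (hΨ : ∀ A : (i : Fin k) → Herm (Fin (n i)),
      Ψ (tensorHerm A) = tensorHerm fun i => ψ i (castHerm (h i) (A (π i)))) :
    Ψ '' productPureStates n = productPureStates n := by
  ext T
  constructor
  · rintro ⟨_, ⟨P, hP, rfl⟩, rfl⟩
    refine ⟨_, fun i => ?_, hΨ P⟩
    rw [← (hψ i).image_pureStates]
    exact ⟨_, castHerm_mem_pureStates (h i) (hP (π i)), rfl⟩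
  · rintro ⟨Q, hQ, rfl⟩
    have hQ' : ∀ i, ∃ P ∈ pureStates (Fin (n i)), ψ i P = Q i := fun i => by
      have := hQ i
      rwa [← (hψ i).image_pureStates] at this
    choose P hP hPQ using hQ'
    let A := Equiv.piCongrLeft (fun j => Herm (Fin (n j))) π fun i => castHerm (h i).symm (P i)
    have hA : ∀ i, A (π i) = castHerm (h i).symm (P i) := fun i =>
      Equiv.piCongrLeft_apply_apply _ _ _ _
    refine ⟨tensorHerm A, ⟨A, fun j => ?_, rfl⟩, ?_⟩
    · obtain ⟨i, rfl⟩ := π.surjective j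
      rw [hA]
      exact castHerm_mem_pureStates _ (hP i)
    · rw [hΨ]
      refine congrArg tensorHerm (funext fun i => ?_)
      rw [hA, castHerm_castHerm_symm, hPQ]

/-! ### The form of maps preserving product pure states -/

theorem nontrivial_pureStates {m : ℕ} (hm : 2 ≤ m) : Nontrivial (pureStates (Fin m)) := by
  have hE : ∀ j : Fin m, outerHerm (Pi.single j (1 : ℂ)) ∈ pureStates (Fin m) := fun j =>
    outerHerm_mem_pureStates (by simp)
  refine ⟨⟨⟨_, hE ⟨0, by omega⟩⟩, ⟨_, hE ⟨1, by omega⟩⟩, fun h => ?_⟩⟩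
  have h2 := congrArg (fun A : pureStates (Fin m) =>
    ((A : Herm (Fin m)) : Matrix (Fin m) (Fin m) ℂ) ⟨0, by omega⟩ ⟨0, by omega⟩) h
  simp [outerHerm_apply] at h2

/-- The coordinate form of `Ψ` on product pure states. -/
theorem exists_perm_of_image_productPureStates (hn : ∀ i, 2 ≤ n i)
    {Ψ : Herm (ProdIdx n) →ₗ[ℝ] Herm (ProdIdx n)}
    (h : Ψ '' productPureStates n = productPureStates n) :
    ∃ (π : Equiv.Perm (Fin k)) (φ : (i : Fin k) → pureStates (Fin (n (π i))) →
      pureStates (Fin (n i))), (∀ i, Function.Injective (φ i)) ∧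
      ∀ p, Ψ (productState p) = productState fun i => φ i (p (π i)) := by
  have hinj : Function.Injective Ψ := by
    refine injective_of_span_image span_productPureStates ?_
    conv_lhs => rw [← h]
    exact Set.image_mono Submodule.subset_span
  have hex : ∀ p, ∃ q, productState q = Ψ (productState p) := fun p =>
    mem_productPureStates_iff.1 (by rw [← h]; exact ⟨_, productState_mem p, rfl⟩)
  choose g hg using hex
  have hgbij : Function.Bijective g := by
    constructor
    · intro p q hpq
      apply productState_injective
      apply hinj
      rw [← hg, ← hg, hpq]
    · intro q
      have hq := productState_mem q
      rw [← h] at hq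
      obtain ⟨T, hT, hTq⟩ := hq
      obtain ⟨p, rfl⟩ := mem_productPureStates_iff.1 hT
      exact ⟨p, productState_injective (by rw [hg, hTq])⟩
  have : ∀ i, Nontrivial (pureStates (Fin (n i))) := fun i => nontrivial_pureStates (hn i)
  -- Adjacency is expressed through sums of product pure states, which the linear bijection
  -- preserves in both directions.
  obtain ⟨π, φ, hφ⟩ := exists_perm_of_hammingAdj_iff (Equiv.ofBijective g hgbij) (fun p q => by
    rw [Equiv.ofBijective_apply, Equiv.ofBijective_apply, ← sumsAgain_productState_iff, hg, hg,
      sumsAgain_image_iff hinj h, sumsAgain_productState_iff])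
  simp only [Equiv.ofBijective_apply] at hφ
  refine ⟨π, φ, fun i x y hxy => ?_, fun p => ?_⟩
  · have p₀ : (i : Fin k) → pureStates (Fin (n i)) := fun i => Classical.arbitrary _
    have hup : Function.update p₀ (π i) x = Function.update p₀ (π i) y := by
      apply hgbij.1
      funext l
      rw [hφ, hφ]
      by_cases hl : l = i
      · subst hl
        rw [Function.update_self, Function.update_self, hxy]
      · have : π l ≠ π i := fun he => hl (π.injective he)
        rw [Function.update_of_ne this, Function.update_of_ne this]
    have := congrFun hup (π i)
    rwa [Function.update_self, Function.update_self] at this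
  · rw [← hg]
    exact congrArg productState (funext (hφ p))

/-- `A ↦ ψ_1 (A_{π 1}) ⊗ ⋯ ⊗ ψ_k (A_{π k})` as a multilinear map. -/
noncomputable def permutedTensor (π : Equiv.Perm (Fin k))
    (ψ : (i : Fin k) → Herm (Fin (n (π i))) →ₗ[ℝ] Herm (Fin (n i))) :
    MultilinearMap ℝ (fun i => Herm (Fin (n i))) (Herm (ProdIdx n)) where
  toFun A := ((tensorHermMap n).compLinearMap ψ) fun i => A (π i)
  map_update_add' A j X Y := by
    rename_i inst
    obtain rfl : inst = instDecidableEqFin k := Subsingleton.elim _ _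
    obtain ⟨l, rfl⟩ := π.surjective j
    simp only [Function.update_comp_eq_of_injective' A π.injective, MultilinearMap.map_update_add]
  map_update_smul' A j c X := by
    rename_i inst
    obtain rfl : inst = instDecidableEqFin k := Subsingleton.elim _ _
    obtain ⟨l, rfl⟩ := π.surjective j
    simp only [Function.update_comp_eq_of_injective' A π.injective, MultilinearMap.map_update_smul]

theorem permutedTensor_apply (π : Equiv.Perm (Fin k))
    (ψ : (i : Fin k) → Herm (Fin (n (π i))) →ₗ[ℝ] Herm (Fin (n i)))
    (A : (i : Fin k) → Herm (Fin (n i))) :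
    permutedTensor π ψ A = tensorHerm fun i => ψ i (A (π i)) := rfl

theorem le_of_conjTranspose_mul_self {m m' : ℕ} {U : Matrix (Fin m') (Fin m) ℂ}
    (h : Uᴴ * U = 1) : m ≤ m' := by
  have h1 := Matrix.rank_mul_le_right Uᴴ U
  rw [h, Matrix.rank_one, Fintype.card_fin] at h1
  exact h1.trans (by simpa using Matrix.rank_le_height U)

theorem exists_isUnitaryConjOrTranspose {m m' : ℕ} (h : m = m')
    {ψ : Herm (Fin m) →ₗ[ℝ] Herm (Fin m')} {U : Matrix (Fin m') (Fin m) ℂ} (hU : Uᴴ * U = 1)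
    (hψ : (∀ X, (ψ X : Matrix (Fin m') (Fin m') ℂ) = U * (X : Matrix (Fin m) (Fin m) ℂ) * Uᴴ) ∨
      (∀ X, (ψ X : Matrix (Fin m') (Fin m') ℂ) = U * (X : Matrix (Fin m) (Fin m) ℂ)ᵀ * Uᴴ)) :
    ∃ ψ' : Herm (Fin m') →ₗ[ℝ] Herm (Fin m'), IsUnitaryConjOrTranspose ψ' ∧
      ∀ X, ψ X = ψ' (castHerm h X) := by
  subst h
  exact ⟨ψ, ⟨U, Matrix.mem_unitaryGroup_iff'.2 hU, hψ⟩, fun X => rfl⟩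

theorem exists_form_of_image_productPureStates (hn : ∀ i, 2 ≤ n i)
    {Ψ : Herm (ProdIdx n) →ₗ[ℝ] Herm (ProdIdx n)}
    (h : Ψ '' productPureStates n = productPureStates n) :
    ∃ (π : Equiv.Perm (Fin k)) (h : ∀ i, n (π i) = n i)
      (ψ : (i : Fin k) → Herm (Fin (n i)) →ₗ[ℝ] Herm (Fin (n i))),
      (∀ i, IsUnitaryConjOrTranspose (ψ i)) ∧
      ∀ A : (i : Fin k) → Herm (Fin (n i)),
        Ψ (tensorHerm A) = tensorHerm fun i => ψ i (castHerm (h i) (A (π i))) := by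
  obtain ⟨π, φ, hφinj, hφ⟩ := exists_perm_of_image_productPureStates hn h
  have : ∀ i, Nontrivial (pureStates (Fin (n i))) := fun i => nontrivial_pureStates (hn i)
  have p₀ : (i : Fin k) → pureStates (Fin (n i)) := fun i => Classical.arbitrary _
  -- Varying slot `π i` with the others frozen at `p₀`, then tracing out all but factor `i`, gives a
  -- linear extension of `φ i`.
  let χ : (i : Fin k) → Herm (Fin (n (π i))) →ₗ[ℝ] Herm (Fin (n i)) := fun i =>
    partialTrace n i ∘ₗ Ψ ∘ₗ
      (tensorHermMap n).toLinearMap (fun j => (p₀ j : Herm (Fin (n j)))) (π i)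
  have hχ : ∀ i (x : pureStates (Fin (n (π i)))), χ i x = φ i x := by
    intro i x
    have h1 : tensorHermMap n (Function.update (fun j => (p₀ j : Herm (Fin (n j)))) (π i) x) =
        productState (Function.update p₀ (π i) x) := by
      rw [tensorHermMap_apply]
      refine congrArg tensorHerm (funext fun l => ?_)
      by_cases hl : l = π i
      · subst hl; simp
      · simp [Function.update_of_ne hl]
    change partialTrace n i (Ψ (tensorHermMap n _)) = _
    rw [h1, hφ, productState, partialTrace_tensorHerm fun l _ => (φ l _).2.2,
      Function.update_self]
  have hiso : ∀ i, ∃ U : Matrix (Fin (n i)) (Fin (n (π i))) ℂ, Uᴴ * U = 1 ∧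
      ((∀ X, (χ i X : Matrix (Fin (n i)) (Fin (n i)) ℂ) =
          U * (X : Matrix (Fin (n (π i))) (Fin (n (π i))) ℂ) * Uᴴ) ∨
        (∀ X, (χ i X : Matrix (Fin (n i)) (Fin (n i)) ℂ) =
          U * (X : Matrix (Fin (n (π i))) (Fin (n (π i))) ℂ)ᵀ * Uᴴ)) := by
    intro i
    have : Nonempty (Fin (n (π i))) := ⟨⟨0, by have := hn (π i); omega⟩⟩
    refine exists_isometry_of_pureStates (χ i) (fun P hP => ?_) (fun P hP Q hQ hPQ => ?_)
    · rw [hχ i ⟨P, hP⟩]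
      exact (φ i ⟨P, hP⟩).2
    · rw [hχ i ⟨P, hP⟩, hχ i ⟨Q, hQ⟩] at hPQ
      exact congrArg Subtype.val (hφinj i (Subtype.ext hPQ))
  choose U hU hUχ using hiso
  have hle : ∀ i ∈ Finset.univ, n (π i) ≤ n i := fun i _ => le_of_conjTranspose_mul_self (hU i)
  -- Termwise inequalities between sums that agree under the permutation are equalities.
  have hnπ : ∀ i, n (π i) = n i := fun i =>
    (Finset.sum_eq_sum_iff_of_le hle).1 (Equiv.sum_comp π n) i (Finset.mem_univ i)
  choose ψ hψ hχψ using fun i => exists_isUnitaryConjOrTranspose (hnπ i) (hU i) (hUχ i)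
  refine ⟨π, hnπ, ψ, hψ, fun A => ?_⟩
  -- The difference of the two multilinear maps vanishes on families of pure states, which span each
  -- factor.
  have key := (Ψ.compMultilinearMap (tensorHermMap n) - permutedTensor π χ).mem_of_span_eq_top
    (fun i => pureStates (Fin (n i))) (fun i => span_pureStates) ⊥ (fun m hm => by
      rw [Submodule.mem_bot, sub_apply, sub_eq_zero,
        LinearMap.compMultilinearMap_apply, tensorHermMap_apply, permutedTensor_apply]
      refine (hφ fun i => ⟨m i, hm i⟩).trans (congrArg tensorHerm (funext fun i => ?_))
      exact (hχ i ⟨m (π i), hm (π i)⟩).symm) A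
  rw [Submodule.mem_bot, sub_apply, sub_eq_zero,
    LinearMap.compMultilinearMap_apply, tensorHermMap_apply, permutedTensor_apply] at key
  rw [key]
  exact congrArg tensorHerm (funext fun i => hχψ i _)

end Main

theorem theorem3p1 {k : ℕ} (hk : 1 < k) (n : Fin k → ℕ) (hanti : Antitone n)
    (hn : ∀ i, 2 ≤ n i) (Ψ : Herm (ProdIdx n) →ₗ[ℝ] Herm (ProdIdx n)) :
    List.TFAE [
      Ψ '' productPureStates n = productPureStates n,
      Ψ '' separableStates n = separableStates n,
      ∃ (π : Equiv.Perm (Fin k)) (h : ∀ i, n (π i) = n i)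
        (ψ : (i : Fin k) → Herm (Fin (n i)) →ₗ[ℝ] Herm (Fin (n i))),
        (∀ i, IsUnitaryConjOrTranspose (ψ i)) ∧
        ∀ A : (i : Fin k) → Herm (Fin (n i)),
          Ψ (tensorHerm A) = tensorHerm fun i => ψ i (castHerm (h i) (A (π i)))] := by
  tfae_have 1 → 2 := fun h => by
    rw [separableStates, Ψ.image_convexHull, h]
  tfae_have 2 → 1 := image_productPureStates_of_image_separableStates
  tfae_have 1 → 3 := exists_form_of_image_productPureStates hn
  tfae_have 3 → 1 := fun ⟨_, _, _, hψ, hΨ⟩ => image_productPureStates_of_form hψ hΨ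
  tfae_finish
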